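/- For $t\in\mathbb R$ let $M_1(t),\dots,M_4(t)$ be the real symmetric matrices \[ \left(\begin{smallmatrix}16+2t&24+t&24+t&-8&-8\\24+t&16+2t&24+t&8&0\\24+t&24+t&16+2t&0&8\\-8&8&0&16&8\\-8&0&8&8&16\end{smallmatrix}\right),\ \left(\begin{smallmatrix}16+2t&-8+t&-8+t&8&8\\-8+t&-16+2t&-8+t&8&16\\-8+t&-8+t&-16+2t&16&8\\8&8&16&16&8\\8&16&8&8&16\end{smallmatrix}\right), \] \[ \left(\begin{smallmatrix}-16+2t&-8+t&-8+t&-8&8\\-8+t&16+2t&-8+t&-8&0\\-8+t&-8+t&-16+2t&-16&-8\\-8&-8&-16&16&8\\8&0&-8&8&16\end{smallmatrix}\right),\ \left(\begin{smallmatrix}-16+2t&-8+t&-8+t&8&-8\\-8+t&-16+2t&-8+t&-8&-16\\-8+t&-8+t&16+2t&0&-8\\8&-8&0&16&8\\-8&-16&-8&8&16\end{smallmatrix}\right) \] and put $A_t(x)=\sum_{i=1}^4 x_iM_i(t)$. Let $\mathfrak S_4$ act on $\mathbb P^3$ by permuting the coordinates. Call a real point $[x]$, $x\in\mathbb R^4\setminus\{0\}$,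 semidefinite if $A_t(x)$ or $-A_t(x)$ is positive semidefinite, and indefinite otherwise; the (projective) spectrahedron of $A_t$ is the set of all semidefinite real points. (0) The family is $\mathfrak S_4$-invariant: there is a homomorphism $\rho:\mathfrak S_4\to \mathrm{GL}_5(\mathbb R)$ such that $A_t(\sigma x)=\rho(\sigma)A_t(x)\rho(\sigma)^{\mathsf T}$ for all $t\in\mathbb R$, $\sigma\in\mathfrak S_4$ and $x\in\mathbb R^4$. (1) Let $t\in\mathbb R\setminus\{-2,0,12,16,48\}$. There are exactly $20$ points $[x]\in\mathbb P^3(\mathbb C)$ with $\operatorname{rank}A_t(x)\le 3$. At each of them the rank is exactly $3$ and the quintic surface $\det A_t(x)=0$ has a node (an ordinary double point). The $20$ points split up into three $\mathfrak S_4$-orbits, one of length $12$ and two of length $4$, and: - if $48<t$, both $4$-orbits consist of semidefinite real points, and the $12$-orbit consists of indefinite real points; - if $12<t<48$, one $4$-orbit consists of semidefinite real points and the other one of indefinite real points, and the $12$-orbit consists of semidefinite real points; - if $0<t<12$, one $4$-orbit consists of semidefinite real points and the other one of indefinite real points, and the $12$-orbit consists of nonreal points; - if $-2<t<0$, both $4$-orbits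 consist of indefinite real points, and the $12$-orbit consists of nonreal points; - if $t<-2$, none of the $20$ points is real. (2) For every $t<0$ the spectrahedron of $A_t$ is empty. -/

import Mathlib

open scoped LinearAlgebra.Projectivization

namespace TetrahedralSymmetroid

/-- The images of the four unit vectors under the family of linear maps
`φ_t : V → Sym₂(U)`, `dim V = 4`, `dim U = 5`. -/
def gen {R : Type*} [CommRing R] (t : R) : Fin 4 → Matrix (Fin 5) (Fin 5) R :=
  ![!![16 + 2 * t, 24 + t, 24 + t, -8, -8;
       24 + t, 16 + 2 * t, 24 + t, 8, 0;
       24 + t, 24 + t, 16 + 2 * t, 0, 8;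
       -8, 8, 0, 16, 8;
       -8, 0, 8, 8, 16],
    !![16 + 2 * t, -8 + t, -8 + t, 8, 8;
       -8 + t, -16 + 2 * t, -8 + t, 8, 16;
       -8 + t, -8 + t, -16 + 2 * t, 16, 8;
       8, 8, 16, 16, 8;
       8, 16, 8, 8, 16],
    !![-16 + 2 * t, -8 + t, -8 + t, -8, 8;
       -8 + t, 16 + 2 * t, -8 + t, -8, 0;
       -8 + t, -8 + t, -16 + 2 * t, -16, -8;
       -8, -8, -16, 16, 8;
       8, 0, -8, 8, 16],
    !![-16 + 2 * t, -8 + t, -8 + t, 8, -8;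
       -8 + t, -16 + 2 * t, -8 + t, -8, -16;
       -8 + t, -8 + t, 16 + 2 * t, 0, -8;
       8, -8, 0, 16, 8;
       -8, -16, -8, 8, 16]]

/-- The symmetric matrix `φ_t(x) = ∑ xᵢ Mᵢ(t)`, with entries in any commutative ring. -/
def pencil {R : Type*} [CommRing R] (t : R) (x : Fin 4 → R) : Matrix (Fin 5) (Fin 5) R :=
  ∑ i, x i • gen t i

/-- Complex projective 3-space. -/
abbrev CP3 : Type := ℙ ℂ (Fin 4 → ℂ)

/-- Real projective 3-space. -/
abbrev RP3 : Type := ℙ ℝ (Fin 4 → ℝ)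

/-- The quintic form `det φ_t(x)` in the variables `x₁, …, x₄`, which defines the symmetroid. -/
noncomputable def symmetroidForm (t : ℝ) : MvPolynomial (Fin 4) ℂ :=
  (pencil (MvPolynomial.C (t : ℂ)) MvPolynomial.X).det

/-- The points of complex projective space represented by matrices of corank at least two
(the rank 3 locus). -/
def nodes (t : ℝ) : Set CP3 :=
  {p | (pencil (t : ℂ) p.rep).rank ≤ 3}

/-- `p` is an ordinary double point of the projective surface `F = 0`: the form and its first
partial derivatives vanish at `p`, and its Hessian at `p` (whose kernel always contains the line
`p`, by Euler's relation) has rank three. -/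
def IsNode (F : MvPolynomial (Fin 4) ℂ) (p : CP3) : Prop :=
  MvPolynomial.eval p.rep F = 0 ∧
  (∀ i, MvPolynomial.eval p.rep (MvPolynomial.pderiv i F) = 0) ∧
  (Matrix.of fun i j : Fin 4 =>
    MvPolynomial.eval p.rep (MvPolynomial.pderiv i (MvPolynomial.pderiv j F))).rank = 3

/-- The action of `σ ∈ S₄` on complex projective space by permuting the coordinates,
`eⱼ ↦ e_{σ j}`. -/
noncomputable def permPoint (σ : Equiv.Perm (Fin 4)) : CP3 → CP3 :=
  Projectivization.map (LinearMap.funLeft ℂ ℂ (σ⁻¹ : Equiv.Perm (Fin 4)))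
    (LinearMap.funLeft_injective_of_surjective ℂ ℂ _ (σ⁻¹ : Equiv.Perm (Fin 4)).surjective)

/-- `O` is an orbit of `S₄` acting on complex projective space. -/
def IsS4Orbit (O : Set CP3) : Prop :=
  ∃ p : CP3, O = Set.range fun σ : Equiv.Perm (Fin 4) => permPoint σ p

/-- The inclusion `ℝ⁴ → ℂ⁴`. -/
noncomputable def complexify : (Fin 4 → ℝ) →ₛₗ[algebraMap ℝ ℂ] (Fin 4 → ℂ) where
  toFun v := fun i => (v i : ℂ)
  map_add' v w := by ext i; simp
  map_smul' c v := by ext i; simp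

theorem complexify_injective : Function.Injective complexify := by
  intro v w h
  ext i
  exact Complex.ofReal_injective (congrFun h i)

/-- The inclusion of real into complex projective space. -/
noncomputable def toComplex : RP3 → CP3 :=
  Projectivization.map complexify complexify_injective

/-- The projective spectrahedron: the real points at which the matrix is positive semidefinite
after multiplication with a suitable sign. -/
def spectrahedron (t : ℝ) : Set RP3 :=
  {q | (pencil t q.rep).PosSemidef ∨ (-pencil t q.rep).PosSemidef}

/-- `p` is a real point represented by a semidefinite matrix. -/
def IsRealSemidefinite (t : ℝ) (p : CP3) : Prop :=
  ∃ q : RP3, toComplex q = p ∧ q ∈ spectrahedron t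

/-- `p` is a real point represented by an indefinite matrix. -/
def IsRealIndefinite (t : ℝ) (p : CP3) : Prop :=
  ∃ q : RP3, toComplex q = p ∧ q ∉ spectrahedron t

/-- `p` is not a real point. -/
def IsNonreal (p : CP3) : Prop :=
  ¬ ∃ q : RP3, toComplex q = p

end TetrahedralSymmetroid

namespace TetrahedralSymmetroid

/-! The Hadamard change of coordinates `had` and the constant change of basis `framing` turn the
pencil into 4 times a congruent copy of `blk t z`. There `z 0` is a quarter of the coordinate sum of
`x`, and the lower right 2 × 2 block is `z 0` times a constant positive definite matrix. A point
with `z 0 = 0` has rank at least 4 (`blk_infinity`), so one may normalize `z = (1, a, b, c)`. Rank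
at most 3 then means that the Schur complement of the lower block, a symmetric 3 × 3 matrix, has
rank at most 1.

The 2 × 2 minors of the Schur complement (`blk_minors`) force two of `a²`, `b²`, `c²` to agree, that
is, two coordinates of `x` to coincide. After a permutation `a = b`, and the remaining equations can
be solved (`blk_symmetric`). Either the point has three equal coordinates, with parameter a root of
`8a² + 8a = t`; the two roots give the two 4-orbits. Or `c = 3 - t/8` and `a² = 3 - 2c`; this gives
the 12-orbit, on which the sign of `a` only exchanges the two special coordinates.

At each solution the Schur complement is `p` times the square of a nonzero vector, so the matrix is
congruent to a definite 2 × 2 block plus `p` plus zeros (`hasCore_blk`). Hence the rank is 3 iff `p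
≠ 0`, and a real point is semidefinite iff `0 ≤ p` (`HasCore.posSemidef_iff`). The values of `p` are
explicit (`hasCore_star`, `hasCore_pairPt`), and their signs, with the reality of the square roots
of `1 + t/2` and `(t - 12)/4`, yield the table of cases.

Nodes are detected on the explicit quintic `quinticFun`: a 3 × 3 minor of its Hessian factors into
terms that vanish only at excluded `t` (`nodeAt_quintic_diag`, `nodeAt_quintic_pair`). For `t < 0`,
two diagonal entries of `blk` have opposite signs unless `z 0 = 0`, which forces `z = 0` for a
semidefinite matrix. -/

/-! ### The five-dimensional representation of `S₄` -/

/-- The three splittings of four letters into pairs, written as sign vectors. -/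
def pairSign : Fin 3 → Fin 4 → ℤ := ![![1, 1, -1, -1], ![1, -1, 1, -1], ![1, -1, -1, 1]]

/-- The standard three-dimensional representation of `S₄` by signed permutation matrices. -/
def signedPerm (σ : Equiv.Perm (Fin 4)) (i j : Fin 3) : ℤ :=
  (∑ k, pairSign i (σ k) * pairSign j k) / 4

/-- The sum of the standard representation and of the two-dimensional one, in the basis in
which the matrices `gen t i` are given. -/
def repInt (σ : Equiv.Perm (Fin 4)) : Matrix (Fin 5) (Fin 5) ℤ :=
  let w := signedPerm σ
  -- `T` is the upper block of `framing` and `T * S = 2`, so `a` is the conjugate of `w` by `T`. The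
  -- squares `w i j ^ 2` form the permutation matrix of the three splittings; `e` is its action on
  -- differences with the coordinate 0. Both integer divisions are exact.
  let T : Fin 3 → Fin 3 → ℤ := fun i j => if i = j then 0 else 1
  let S : Fin 3 → Fin 3 → ℤ := fun i j => if i = j then -1 else 1
  let a : Fin 3 → Fin 3 → ℤ := fun i j => (∑ k, (∑ l, T i k * w k l * S l j)) / 2
  let e : Fin 3 → Fin 3 → ℤ := fun i j => w i j ^ 2 - w 0 j ^ 2
  !![a 0 0, a 0 1, a 0 2, 0, 0;
     a 1 0, a 1 1, a 1 2, 0, 0;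
     a 2 0, a 2 1, a 2 2, 0, 0;
     0, 0, 0, e 1 1, e 1 2;
     0, 0, 0, e 2 1, e 2 2]

set_option maxRecDepth 100000 in
theorem repInt_one : repInt 1 = 1 := by
  decide +kernel

set_option maxRecDepth 100000 in
theorem repInt_mul_swap (σ : Equiv.Perm (Fin 4)) (i : Fin 3) :
    repInt (σ * Equiv.swap i.castSucc i.succ) =
      repInt σ * repInt (Equiv.swap i.castSucc i.succ) := by
  revert σ i; decide +kernel

set_option maxRecDepth 100000 in
theorem repInt_gen_swap (i : Fin 3) (j : Fin 4) :
    gen (0 : ℤ) (Equiv.swap i.castSucc i.succ j) =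
      repInt (Equiv.swap i.castSucc i.succ) * gen 0 j *
        (repInt (Equiv.swap i.castSucc i.succ)).transpose := by
  revert i j; decide +kernel

set_option maxRecDepth 100000 in
theorem repInt_slope_swap (i : Fin 3) :
    gen (1 : ℤ) 0 - gen 0 0 =
      repInt (Equiv.swap i.castSucc i.succ) * (gen 1 0 - gen 0 0) *
        (repInt (Equiv.swap i.castSucc i.succ)).transpose := by
  revert i; decide +kernel

/-- Induction over products of adjacent transpositions. -/
theorem perm_induction {P : Equiv.Perm (Fin 4) → Prop} (h1 : P 1)
    (hs : ∀ i : Fin 3, P (Equiv.swap i.castSucc i.succ)) (hm : ∀ σ τ, P σ → P τ → P (σ * τ))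
    (σ : Equiv.Perm (Fin 4)) : P σ := by
  have hσ : σ ∈ Submonoid.closure (Set.range fun i : Fin 3 => Equiv.swap i.castSucc i.succ) := by
    rw [Equiv.Perm.mclosure_swap_castSucc_succ]; trivial
  induction hσ using Submonoid.closure_induction with
  | mem τ h => obtain ⟨i, rfl⟩ := h; exact hs i
  | one => exact h1
  | mul σ τ _ _ h h' => exact hm σ τ h h'

/-- Right multiplication by adjacent transpositions is a finite check, and these generate the group.
-/
theorem repInt_mul (σ τ : Equiv.Perm (Fin 4)) : repInt (σ * τ) = repInt σ * repInt τ := by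
  induction τ using perm_induction generalizing σ with
  | h1 => rw [mul_one, repInt_one, mul_one]
  | hs i => exact repInt_mul_swap σ i
  | hm τ τ' h h' => rw [← mul_assoc, h', h σ, h' τ, mul_assoc]

theorem repInt_gen (σ : Equiv.Perm (Fin 4)) (j : Fin 4) :
    gen (0 : ℤ) (σ j) = repInt σ * gen 0 j * (repInt σ).transpose := by
  induction σ using perm_induction generalizing j with
  | h1 => simp [repInt_one]
  | hs i => exact repInt_gen_swap i j
  | hm σ τ h h' =>
    rw [Equiv.Perm.mul_apply, h, h', repInt_mul, Matrix.transpose_mul]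
    simp only [Matrix.mul_assoc]

theorem repInt_slope (σ : Equiv.Perm (Fin 4)) :
    gen (1 : ℤ) 0 - gen 0 0 = repInt σ * (gen 1 0 - gen 0 0) * (repInt σ).transpose := by
  induction σ using perm_induction with
  | h1 => simp [repInt_one]
  | hs i => exact repInt_slope_swap i
  | hm σ τ h h' =>
    conv_lhs => rw [h, h']
    rw [repInt_mul, Matrix.transpose_mul]
    simp only [Matrix.mul_assoc]

/-- The representation `repInt` over an arbitrary commutative ring. -/
def rep (R : Type*) [CommRing R] (σ : Equiv.Perm (Fin 4)) : Matrix (Fin 5) (Fin 5) R :=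
  (repInt σ).map (Int.castRingHom R)

/-- The coefficient of `t` is the same integer matrix for all four generators, so equivariance for
every `t` over every ring reduces to integer identities at `t = 0` and for this one matrix. -/
theorem gen_eq {R : Type*} [CommRing R] (t : R) (j : Fin 4) :
    gen t j = (gen (0 : ℤ) j).map (Int.castRingHom R) +
      t • (gen (1 : ℤ) 0 - gen 0 0).map (Int.castRingHom R) := by
  fin_cases j <;> ext i k <;> fin_cases i <;> fin_cases k <;> simp [gen] <;> ring

theorem rep_mul {R : Type*} [CommRing R] (σ τ : Equiv.Perm (Fin 4)) :
    rep R (σ * τ) = rep R σ * rep R τ := by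
  rw [rep, repInt_mul, Matrix.map_mul]; rfl

theorem rep_one {R : Type*} [CommRing R] : rep R 1 = 1 := by
  rw [rep, repInt_one, Matrix.map_one _ (map_zero _) (map_one _)]

theorem gen_equivariant {R : Type*} [CommRing R] (t : R) (σ : Equiv.Perm (Fin 4)) (j : Fin 4) :
    gen t (σ j) = rep R σ * gen t j * (rep R σ).transpose := by
  rw [gen_eq t (σ j), gen_eq t j, repInt_gen, Matrix.mul_add, Matrix.add_mul, Matrix.mul_smul,
    Matrix.smul_mul]
  conv_lhs => rw [repInt_slope σ]
  simp only [Matrix.map_mul, Matrix.transpose_map, rep]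

theorem pencil_equivariant {R : Type*} [CommRing R] (t : R) (σ : Equiv.Perm (Fin 4))
    (x : Fin 4 → R) :
    pencil t (fun i => x (σ⁻¹ i)) = rep R σ * pencil t x * (rep R σ).transpose := by
  rw [pencil, pencil, ← Equiv.sum_comp σ, Finset.mul_sum, Finset.sum_mul]
  refine Finset.sum_congr rfl fun j _ => ?_
  rw [gen_equivariant, Matrix.mul_smul, Matrix.smul_mul, ← Equiv.Perm.mul_apply,
    inv_mul_cancel, Equiv.Perm.one_apply]

/-- The representation of `S₄` as a homomorphism to the general linear group. -/
def repHom (R : Type*) [CommRing R] :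
    Equiv.Perm (Fin 4) →* Matrix.GeneralLinearGroup (Fin 5) R :=
  MonoidHom.toHomUnits
    { toFun := rep R
      map_one' := rep_one
      map_mul' := rep_mul }

theorem exists_equivariant_rep : ∃ ρ : Equiv.Perm (Fin 4) →* Matrix.GeneralLinearGroup (Fin 5) ℝ,
    ∀ (t : ℝ) (σ : Equiv.Perm (Fin 4)) (x : Fin 4 → ℝ),
      pencil t (fun i => x (σ⁻¹ i)) =
        (ρ σ : Matrix (Fin 5) (Fin 5) ℝ) * pencil t x *
          (ρ σ : Matrix (Fin 5) (Fin 5) ℝ).transpose :=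
  ⟨repHom ℝ, fun t σ x => pencil_equivariant t σ x⟩

theorem isUnit_rep {R : Type*} [CommRing R] (σ : Equiv.Perm (Fin 4)) : IsUnit (rep R σ) :=
  (repHom R σ).isUnit

theorem rank_pencil_perm {K : Type*} [Field K] (t : K) (σ : Equiv.Perm (Fin 4)) (x : Fin 4 → K) :
    (pencil t (fun i => x (σ⁻¹ i))).rank = (pencil t x).rank := by
  have h := (Matrix.isUnit_iff_isUnit_det _).1 (isUnit_rep (R := K) σ)
  rw [pencil_equivariant, Matrix.rank_mul_eq_left_of_isUnit_det,
    Matrix.rank_mul_eq_right_of_isUnit_det _ _ h]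
  rwa [Matrix.det_transpose]

theorem pencil_smul {R : Type*} [CommRing R] (t c : R) (x : Fin 4 → R) :
    pencil t (c • x) = c • pencil t x := by
  simp [pencil, Finset.smul_sum, smul_smul]

/-! ### Nodes and linear changes of coordinates -/

section Calculus

open MvPolynomial

variable {K : Type*} [Field K] {n : Type*} [Fintype n] [DecidableEq n]

/-- The Hessian matrix of a polynomial at a point. -/
noncomputable def hessian (F : MvPolynomial n K) (v : n → K) : Matrix n n K :=
  Matrix.of fun i j => eval v (pderiv i (pderiv j F))

/-- The linear substitution given by a square matrix. -/
noncomputable def linSubst (N : Matrix n n K) : MvPolynomial n K →ₐ[K] MvPolynomial n K :=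
  aeval fun i => ∑ j, C (N i j) * X j

omit [DecidableEq n] in
theorem eval_linSubst (N : Matrix n n K) (F : MvPolynomial n K) (v : n → K) :
    eval v (linSubst N F) = eval (N.mulVec v) F := by
  induction F using MvPolynomial.induction_on with
  | C a => simp [linSubst]
  | add p q hp hq => simp [hp, hq]
  | mul_X p i hp => rw [map_mul, map_mul, hp]; simp [linSubst, Matrix.mulVec, dotProduct]

theorem pderiv_linSubst (N : Matrix n n K) (F : MvPolynomial n K) (j : n) :
    pderiv j (linSubst N F) = ∑ i, C (N i j) * linSubst N (pderiv i F) := by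
  induction F using MvPolynomial.induction_on with
  | C a => simp [linSubst]
  | add p q hp hq => simp [hp, hq, mul_add, Finset.sum_add_distrib]
  | mul_X p k hp =>
    have hX : linSubst N (X k) = ∑ j, C (N k j) * X j := by simp [linSubst]
    have hd : pderiv j (linSubst N (X k)) = C (N k j) := by
      simp [hX, pderiv_X, Pi.single_apply, Derivation.leibniz]
    rw [map_mul, Derivation.leibniz, hd, hp]
    simp only [Derivation.leibniz, pderiv_X, map_add, smul_eq_mul, map_mul, mul_add,
      Finset.sum_add_distrib, Finset.mul_sum, Pi.single_apply]
    congr 1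
    · rw [Finset.sum_eq_single k]
      · simp; ring
      · intro b _ hb; simp [hb.symm]
      · simp
    · exact Finset.sum_congr rfl fun i _ => by ring

/-- A form whose zero set has an ordinary double point at the point represented by `v`. -/
def NodeAt (F : MvPolynomial n K) (v : n → K) : Prop :=
  eval v F = 0 ∧ (∀ i, eval v (pderiv i F) = 0) ∧ (hessian F v).rank = 3

/-- Chain rule: an invertible substitution `N` multiplies the gradient by the transpose of `N` and
replaces the Hessian `H` by `Nᵀ * H * N`. -/
theorem NodeAt.of_linSubst {F G : MvPolynomial n K} {N : Matrix n n K} {κ : K} {v : n → K}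
    (hN : IsUnit N.det) (hκ : κ ≠ 0) (h : linSubst N F = C κ * G) (hG : NodeAt G v) :
    NodeAt F (N.mulVec v) := by
  obtain ⟨h0, h1, h2⟩ := hG
  have hT : IsUnit N.transpose.det := by rwa [Matrix.det_transpose]
  refine ⟨?_, ?_, ?_⟩
  · rw [← eval_linSubst, h, map_mul, h0, mul_zero]
  · have hz : N.transpose.mulVec (fun i => eval (N.mulVec v) (pderiv i F)) = 0 := by
      ext j
      have := congrArg (fun P => eval v (pderiv j P)) h
      simp only [pderiv_linSubst, pderiv_C_mul, map_sum, map_mul, eval_C, eval_linSubst,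
        h1] at this
      simpa [Matrix.mulVec, dotProduct] using this
    have := Matrix.mulVec_injective_of_isUnit ((Matrix.isUnit_iff_isUnit_det _).2 hT)
      (hz.trans (Matrix.mulVec_zero _).symm)
    exact fun i => congrFun this i
  · have hH : N.transpose * hessian F (N.mulVec v) * N = κ • hessian G v := by
      ext i j
      have := congrArg (fun P => eval v (pderiv i (pderiv j P))) h
      simp only [pderiv_linSubst, pderiv_C_mul, map_sum, map_mul, eval_C, eval_linSubst] at this
      simp only [Matrix.mul_apply, Matrix.transpose_apply, hessian, Matrix.of_apply,
        Matrix.smul_apply, smul_eq_mul]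
      rw [← this]
      refine Finset.sum_congr rfl fun k _ => ?_
      rw [mul_comm, Finset.mul_sum]
    rw [← h2, ← Matrix.rank_smul_of_mem_nonZeroDivisors (hessian G v)
      (mem_nonZeroDivisors_of_ne_zero hκ), ← hH,
      Matrix.rank_mul_eq_left_of_isUnit_det _ _ hN, Matrix.rank_mul_eq_right_of_isUnit_det _ _ hT]

end Calculus

/-! ### The quintic in adapted coordinates -/

/-- The change of coordinates given by the Hadamard matrix of size four. -/
def had {R : Type*} [CommRing R] (z : Fin 4 → R) : Fin 4 → R :=
  ![z 0 + z 1 + z 2 + z 3, z 0 + z 1 - z 2 - z 3, z 0 - z 1 + z 2 - z 3, z 0 - z 1 - z 2 + z 3]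

/-- The matrix `pencil t (had z)` in an adapted basis, divided by four. -/
def blk {R : Type*} [CommRing R] (t : R) (z : Fin 4 → R) : Matrix (Fin 5) (Fin 5) R :=
  !![t * z 0, 8 * z 3, 8 * z 2, 8 * z 1, 8 * z 1;
     8 * z 3, t * z 0, 8 * z 1, -8 * z 2, 0;
     8 * z 2, 8 * z 1, t * z 0, 0, -8 * z 3;
     8 * z 1, -8 * z 2, 0, 16 * z 0, 8 * z 0;
     8 * z 1, 0, -8 * z 3, 8 * z 0, 16 * z 0]

/-- The change of basis between `pencil t (had z)` and `blk t z`. -/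
def framing (R : Type*) [CommRing R] : Matrix (Fin 5) (Fin 5) R :=
  !![0, 1, 1, 0, 0; 1, 0, 1, 0, 0; 1, 1, 0, 0, 0; 0, 0, 0, 1, 0; 0, 0, 0, 0, 1]

theorem pencil_had {R : Type*} [CommRing R] (t : R) (z : Fin 4 → R) :
    pencil t (had z) = (4 : R) • (framing R * blk t z * (framing R).transpose) := by
  ext i j
  simp only [pencil, Fin.sum_univ_four, Matrix.add_apply, Matrix.smul_apply, Matrix.mul_apply,
    Fin.sum_univ_five, Matrix.transpose_apply]
  fin_cases i <;> fin_cases j <;> simp [gen, had, blk, framing] <;> ring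

theorem det_framing {R : Type*} [CommRing R] : (framing R).det = 2 := by
  simp [framing, Matrix.det_succ_row_zero, Fin.sum_univ_succ, Fin.succAbove]
  ring

/-- The determinant of `blk t z`, divided by 64. -/
def quinticFun {R : Type*} [CommRing R] (t : R) (z : Fin 4 → R) : R :=
  3 * t ^ 3 * z 0 ^ 5 - (16 * t ^ 2 + 192 * t) * z 0 ^ 3 * (z 1 ^ 2 + z 2 ^ 2 + z 3 ^ 2) +
    z 0 * (1024 * (z 1 ^ 4 + z 2 ^ 4 + z 3 ^ 4) + (64 * t + 1024) *
      (z 1 ^ 2 * z 2 ^ 2 + z 1 ^ 2 * z 3 ^ 2 + z 2 ^ 2 * z 3 ^ 2)) +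
    1024 * (z 1 ^ 2 + z 2 ^ 2 + z 3 ^ 2) * (z 1 * z 2 * z 3) +
    (3072 - 384 * t) * z 0 ^ 2 * (z 1 * z 2 * z 3)

theorem det_blk {R : Type*} [CommRing R] (t : R) (z : Fin 4 → R) :
    (blk t z).det = 64 * quinticFun t z := by
  simp [blk, Matrix.det_succ_row_zero, Fin.sum_univ_succ, Fin.succAbove]
  rw [quinticFun]
  ring

open MvPolynomial

theorem det_pencil_had {R : Type*} [CommRing R] (t : R) (z : Fin 4 → R) :
    (pencil t (had z)).det = 262144 * quinticFun t z := by
  rw [pencil_had, Matrix.det_smul, Matrix.det_mul, Matrix.det_mul, Matrix.det_transpose, det_blk,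
    det_framing, Fintype.card_fin]
  ring

/-- The quintic form `quinticFun t` as a polynomial. -/
noncomputable def quintic (t : ℂ) : MvPolynomial (Fin 4) ℂ := quinticFun (C t) X

/-- The matrix of the linear map `had`. -/
def hadMatrix (R : Type*) [CommRing R] : Matrix (Fin 4) (Fin 4) R :=
  !![1, 1, 1, 1; 1, 1, -1, -1; 1, -1, 1, -1; 1, -1, -1, 1]

theorem hadMatrix_mulVec {R : Type*} [CommRing R] (z : Fin 4 → R) :
    (hadMatrix R).mulVec z = had z := by
  ext i
  fin_cases i <;> simp [hadMatrix, had, Matrix.mulVec, dotProduct, Fin.sum_univ_four] <;> ring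

theorem det_hadMatrix {R : Type*} [CommRing R] : (hadMatrix R).det = -16 := by
  simp [hadMatrix, Matrix.det_succ_row_zero, Fin.sum_univ_succ, Fin.succAbove]
  ring

theorem map_gen {R S : Type*} [CommRing R] [CommRing S] (f : R →+* S) (t : R) (i : Fin 4) :
    (gen t i).map f = gen (f t) i := by
  rw [gen_eq t, gen_eq (f t)]
  ext j k
  simp

theorem map_pencil {R S : Type*} [CommRing R] [CommRing S] (f : R →+* S) (t : R)
    (x : Fin 4 → R) : (pencil t x).map f = pencil (f t) (fun i => f (x i)) := by
  ext j k
  simp only [pencil, Matrix.map_apply, Matrix.sum_apply, Matrix.smul_apply, map_sum, smul_eq_mul,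
    map_mul, ← map_gen]

theorem linSubst_symmetroidForm (N : Matrix (Fin 4) (Fin 4) ℂ) (t : ℝ) :
    linSubst N (symmetroidForm t) = (pencil (C (t : ℂ)) fun i => ∑ j, C (N i j) * X j).det := by
  have h := (linSubst N).toRingHom.map_det (pencil (C (t : ℂ)) X)
  rw [RingHom.mapMatrix_apply, map_pencil] at h
  refine h.trans ?_
  congr 2
  · simp [linSubst]
  · ext1 i; simp [linSubst]

theorem NodeAt.had {t : ℝ} {z : Fin 4 → ℂ} (h : NodeAt (quintic t) z) :
    NodeAt (symmetroidForm t) (had z) := by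
  rw [← hadMatrix_mulVec]
  refine h.of_linSubst (κ := 262144) (by rw [det_hadMatrix]; norm_num) (by norm_num) ?_
  rw [linSubst_symmetroidForm]
  have : (fun i => ∑ j, C (hadMatrix ℂ i j) * X j) =
      TetrahedralSymmetroid.had (X : Fin 4 → MvPolynomial (Fin 4) ℂ) := by
    ext1 i
    fin_cases i <;> simp [hadMatrix, TetrahedralSymmetroid.had, Fin.sum_univ_four] <;> ring
  rw [this, det_pencil_had]
  rfl

theorem NodeAt.smul {t : ℝ} {x : Fin 4 → ℂ} {c : ℂ} (hc : c ≠ 0)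
    (h : NodeAt (symmetroidForm t) x) : NodeAt (symmetroidForm t) (c • x) := by
  have hx : c • x = (c • (1 : Matrix (Fin 4) (Fin 4) ℂ)).mulVec x := by
    rw [Matrix.smul_mulVec, Matrix.one_mulVec]
  rw [hx]
  refine h.of_linSubst (κ := c ^ 5) ?_ (pow_ne_zero _ hc) ?_
  · simp [hc]
  rw [linSubst_symmetroidForm]
  have : (fun i => ∑ j, C ((c • (1 : Matrix (Fin 4) (Fin 4) ℂ)) i j) * X j) =
      (C c : MvPolynomial (Fin 4) ℂ) • (X : Fin 4 → MvPolynomial (Fin 4) ℂ) := by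
    ext1 i
    simp [Matrix.one_apply, apply_ite C]
  rw [this, pencil_smul, Matrix.det_smul, Fintype.card_fin, symmetroidForm, C_pow]

/-- The representation is invertible over `ℤ`, so its determinant is `±1`; hence permuting
coordinates leaves the quintic unchanged. -/
theorem det_rep_sq {R : Type*} [CommRing R] (σ : Equiv.Perm (Fin 4)) :
    (rep R σ).det ^ 2 = 1 := by
  have h : ∀ σ : Equiv.Perm (Fin 4), (repInt σ).det ^ 2 = 1 := by
    intro σ
    have := (Matrix.isUnit_iff_isUnit_det _).1 (isUnit_rep (R := ℤ) σ)
    have h1 : rep ℤ σ = repInt σ := by ext i j; simp [rep]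
    rw [h1] at this
    exact Int.isUnit_sq this
  have := congrArg (Int.castRingHom R) (h σ)
  rw [map_pow, RingHom.map_det, map_one] at this
  exact this

theorem NodeAt.perm {t : ℝ} {x : Fin 4 → ℂ} (σ : Equiv.Perm (Fin 4))
    (h : NodeAt (symmetroidForm t) x) : NodeAt (symmetroidForm t) (fun i => x (σ⁻¹ i)) := by
  have hx : (fun i => x (σ⁻¹ i)) = (Matrix.of fun i j : Fin 4 =>
      if σ⁻¹ i = j then (1 : ℂ) else 0).mulVec x := by
    ext i
    simp [Matrix.mulVec, dotProduct]
  rw [hx]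
  have hdet : (Matrix.of fun i j : Fin 4 => if σ⁻¹ i = j then (1 : ℂ) else 0).det ^ 2 = 1 := by
    have : (Matrix.of fun i j : Fin 4 => if σ⁻¹ i = j then (1 : ℂ) else 0) =
        (σ⁻¹).permMatrix ℂ := by
      ext i j
      simp [Equiv.Perm.permMatrix, PEquiv.toMatrix_apply, Equiv.toPEquiv_apply, eq_comm]
    rw [this, Matrix.det_permutation]
    rcases Int.units_eq_one_or (Equiv.Perm.sign σ⁻¹) with h | h <;> simp [h]
  refine h.of_linSubst (κ := 1) ?_ one_ne_zero ?_
  · exact IsUnit.of_mul_eq_one _ (by rw [← sq]; exact hdet)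
  rw [linSubst_symmetroidForm]
  have : (fun i => ∑ j, C ((Matrix.of fun i j : Fin 4 => if σ⁻¹ i = j then (1 : ℂ) else 0) i j)
      * X j) = fun i => (X : Fin 4 → MvPolynomial (Fin 4) ℂ) (σ⁻¹ i) := by
    ext1 i
    simp [apply_ite C]
  rw [this, pencil_equivariant, Matrix.det_mul, Matrix.det_mul, Matrix.det_transpose,
    symmetroidForm, C_1, one_mul, mul_right_comm, ← sq, det_rep_sq, one_mul]

/-! ### Nodes of the quintic -/

theorem rank_eq_three_of_det_submatrix {K : Type*} [Field K] (M : Matrix (Fin 4) (Fin 4) K)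
    (v : Fin 4 → K) (hv : v ≠ 0) (h0 : M.mulVec v = 0)
    (h1 : (M.submatrix (Fin.succ : Fin 3 → Fin 4) Fin.succ).det ≠ 0) : M.rank = 3 := by
  apply le_antisymm
  · have h := LinearMap.finrank_range_add_finrank_ker M.mulVecLin
    have hk : 0 < Module.finrank K (LinearMap.ker M.mulVecLin) := by
      have : Nontrivial (LinearMap.ker M.mulVecLin) :=
        ⟨⟨⟨v, h0⟩, 0, fun h => hv (congrArg Subtype.val h)⟩⟩
      exact Module.finrank_pos
    have hr : M.rank = Module.finrank K (LinearMap.range M.mulVecLin) := rfl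
    simp only [Module.finrank_fintype_fun_eq_card, Fintype.card_fin] at h
    omega
  · have h := Matrix.rank_submatrix_le M (Fin.succ : Fin 3 → Fin 4) (Fin.succ : Fin 3 → Fin 4)
    rw [Matrix.rank_of_isUnit _ ((Matrix.isUnit_iff_isUnit_det _).2 h1.isUnit)] at h
    simpa using h

theorem pderiv_ofNat {σ R : Type*} [CommRing R] (i : σ) (n : ℕ) [n.AtLeastTwo] :
    pderiv i (ofNat(n) : MvPolynomial σ R) = 0 :=
  pderiv_C (a := (ofNat(n) : R))

/-- The gradient of `quinticFun t`. -/
def quinticGrad {R : Type*} [CommRing R] (t : R) (z : Fin 4 → R) : Fin 4 → R :=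
  let g (x y w : R) : R := -2 * (16 * t ^ 2 + 192 * t) * z 0 ^ 3 * x + z 0 * (4096 * x ^ 3 +
    2 * (64 * t + 1024) * x * (y ^ 2 + w ^ 2)) + 1024 * (3 * x ^ 2 + y ^ 2 + w ^ 2) * (y * w) +
    (3072 - 384 * t) * z 0 ^ 2 * (y * w)
  ![15 * t ^ 3 * z 0 ^ 4 -
      3 * (16 * t ^ 2 + 192 * t) * z 0 ^ 2 * (z 1 ^ 2 + z 2 ^ 2 + z 3 ^ 2) +
      (1024 * (z 1 ^ 4 + z 2 ^ 4 + z 3 ^ 4) + (64 * t + 1024) *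
        (z 1 ^ 2 * z 2 ^ 2 + z 1 ^ 2 * z 3 ^ 2 + z 2 ^ 2 * z 3 ^ 2)) +
      2 * (3072 - 384 * t) * z 0 * (z 1 * z 2 * z 3),
    g (z 1) (z 2) (z 3), g (z 2) (z 1) (z 3), g (z 3) (z 1) (z 2)]

/-- The Hessian matrix of `quinticFun t`. -/
def quinticHess {R : Type*} [CommRing R] (t : R) (z : Fin 4 → R) : Matrix (Fin 4) (Fin 4) R :=
  let b (x y w : R) : R := -6 * (16 * t ^ 2 + 192 * t) * z 0 ^ 2 * x + (4096 * x ^ 3 +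
    2 * (64 * t + 1024) * x * (y ^ 2 + w ^ 2)) + 2 * (3072 - 384 * t) * z 0 * (y * w)
  let d (x y w : R) : R := -2 * (16 * t ^ 2 + 192 * t) * z 0 ^ 3 + z 0 * (12288 * x ^ 2 +
    2 * (64 * t + 1024) * (y ^ 2 + w ^ 2)) + 6144 * (x * y * w)
  let o (x y w : R) : R := z 0 * (4 * (64 * t + 1024) * (x * y)) +
    1024 * (3 * x ^ 2 + 3 * y ^ 2 + w ^ 2) * w + (3072 - 384 * t) * z 0 ^ 2 * w
  !![60 * t ^ 3 * z 0 ^ 3 -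
      6 * (16 * t ^ 2 + 192 * t) * z 0 * (z 1 ^ 2 + z 2 ^ 2 + z 3 ^ 2) +
      2 * (3072 - 384 * t) * (z 1 * z 2 * z 3),
      b (z 1) (z 2) (z 3), b (z 2) (z 1) (z 3), b (z 3) (z 1) (z 2);
    b (z 1) (z 2) (z 3), d (z 1) (z 2) (z 3), o (z 1) (z 2) (z 3), o (z 1) (z 3) (z 2);
    b (z 2) (z 1) (z 3), o (z 1) (z 2) (z 3), d (z 2) (z 1) (z 3), o (z 2) (z 3) (z 1);
    b (z 3) (z 1) (z 2), o (z 1) (z 3) (z 2), o (z 2) (z 3) (z 1), d (z 3) (z 1) (z 2)]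

theorem pderiv_quintic (t : ℂ) (i : Fin 4) :
    pderiv i (quintic t) = quinticGrad (C t) X i := by
  fin_cases i <;>
    simp [quintic, quinticFun, quinticGrad, pderiv_X, pderiv_ofNat] <;>
    ring

set_option maxHeartbeats 1000000 in
theorem pderiv_quinticGrad (t : ℂ) (i j : Fin 4) :
    pderiv i (quinticGrad (C t) X j) = quinticHess (C t) X i j := by
  fin_cases i <;> fin_cases j <;>
    simp [quinticGrad, quinticHess, pderiv_X, pderiv_ofNat] <;> ring

set_option maxHeartbeats 1000000 in
theorem hessian_quintic (t : ℂ) (z : Fin 4 → ℂ) : hessian (quintic t) z = quinticHess t z := by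
  ext i j
  rw [hessian, Matrix.of_apply, pderiv_quintic, pderiv_quinticGrad]
  fin_cases i <;> fin_cases j <;> simp [quinticHess]

theorem eval_pderiv_quintic (t : ℂ) (z : Fin 4 → ℂ) (i : Fin 4) :
    eval z (pderiv i (quintic t)) = quinticGrad t z i := by
  rw [pderiv_quintic]
  fin_cases i <;> simp [quinticGrad]

/-- By Euler's relation a vanishing gradient makes the form vanish and puts `z` into the kernel of
the Hessian, so a nonzero 3 × 3 minor fixes the rank at 3. -/
theorem nodeAt_quintic_of_det {t : ℂ} {z : Fin 4 → ℂ} (hz : z 0 ≠ 0) (h : quinticGrad t z = 0)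
    (hdet : ((quinticHess t z).submatrix (Fin.succ : Fin 3 → Fin 4) Fin.succ).det ≠ 0) :
    NodeAt (quintic t) z := by
  refine ⟨?_, fun i => ?_, ?_⟩
  · have : 5 * eval z (quintic t) = ∑ i, z i * quinticGrad t z i := by
      simp [quintic, quinticFun, quinticGrad, Fin.sum_univ_four]
      ring
    simpa [h] using this
  · rw [eval_pderiv_quintic, h, Pi.zero_apply]
  · rw [hessian_quintic]
    refine rank_eq_three_of_det_submatrix _ z (fun h => hz (congrFun h 0)) ?_ hdet
    have : (quinticHess t z).mulVec z = (4 : ℂ) • quinticGrad t z := by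
      ext i
      fin_cases i <;>
        simp [quinticHess, quinticGrad, Matrix.mulVec, dotProduct, Fin.sum_univ_four] <;> ring
    rw [this, h, smul_zero]

/-- The Hessian minor is a constant times `a ^ 3 * (a - 1) ^ 4 * (2 * a + 1) ^ 2 * (a + 3) ^ 3`;
with `t = 8a² + 8a` its roots lie over `t = 0, 16, -2, 48`. -/
theorem nodeAt_quintic_diag {a : ℂ} (h0 : a ≠ 0) (h1 : a - 1 ≠ 0) (h2 : 2 * a + 1 ≠ 0)
    (h3 : a + 3 ≠ 0) : NodeAt (quintic (8 * a ^ 2 + 8 * a)) ![1, a, a, a] := by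
  refine nodeAt_quintic_of_det (by simp) ?_ ?_
  · ext i
    fin_cases i <;> simp [quinticGrad] <;> ring
  · have : a ^ 3 * (a - 1) ^ 4 * (2 * a + 1) ^ 2 * (a + 3) ^ 3 ≠ 0 := by simp [*]
    refine ne_of_eq_of_ne ?_ (mul_ne_zero (a := 2048 ^ 2 * 1024) (by norm_num) this)
    simp [Matrix.det_fin_three, quinticHess]
    ring

/-- Here the minor is a constant times `a ^ 2 * (c - 1) ^ 4 * (c + 3) ^ 3`, whose zeros lie over `t
= 12, 16, 48`. -/
theorem nodeAt_quintic_pair {a c : ℂ} (hac : a ^ 2 = 3 - 2 * c) (h0 : a ≠ 0) (h1 : c - 1 ≠ 0)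
    (h3 : c + 3 ≠ 0) : NodeAt (quintic (24 - 8 * c)) ![1, a, a, c] := by
  have hc : c = (3 - a ^ 2) / 2 := by linear_combination hac / 2
  have h : a ^ 2 * (c - 1) ^ 4 * (c + 3) ^ 3 ≠ 0 := by simp [h0, h1, h3]
  rw [hc] at h ⊢
  refine nodeAt_quintic_of_det (by simp) ?_ ?_
  · ext i
    fin_cases i <;> simp [quinticGrad] <;> ring
  · refine ne_of_eq_of_ne ?_ (mul_ne_zero (a := 4 * 1024 ^ 3) (by norm_num) h)
    simp [Matrix.det_fin_three, quinticHess]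
    ring

/-! ### The locus of matrices of rank at most three -/

theorem four_ne_zero_of_charZero (K : Type*) [Field K] [CharZero K] : (4 : K) ≠ 0 := by norm_num

theorem rank_pencil_had {K : Type*} [Field K] [CharZero K] (t : K) (z : Fin 4 → K) :
    (pencil t (had z)).rank = (blk t z).rank := by
  have h : IsUnit (framing K).det := by rw [det_framing]; exact two_ne_zero.isUnit
  have hT : IsUnit (framing K).transpose.det := by rwa [Matrix.det_transpose]
  rw [pencil_had, Matrix.rank_smul_of_mem_nonZeroDivisors _
    (mem_nonZeroDivisors_of_ne_zero (four_ne_zero_of_charZero K)),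
    Matrix.rank_mul_eq_left_of_isUnit_det _ _ hT, Matrix.rank_mul_eq_right_of_isUnit_det _ _ h]

theorem det_submatrix_eq_zero {K m : Type*} [Field K] [Fintype m] {A : Matrix m m K} {r : ℕ}
    (h : A.rank ≤ r) (f g : Fin (r + 1) → m) : (A.submatrix f g).det = 0 := by
  by_contra hne
  have h1 := Matrix.rank_submatrix_le A f g
  rw [Matrix.rank_of_isUnit _ ((Matrix.isUnit_iff_isUnit_det _).2 (Ne.isUnit hne)),
    Fintype.card_fin] at h1
  omega

section

variable {K : Type*} [Field K] [CharZero K] {t a b c : K}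

theorem blk_infinity (h : (blk t ![0, a, b, c]).rank ≤ 3) : a = 0 ∧ b = 0 ∧ c = 0 := by
  -- With `z 0 = 0` the lower block vanishes, so the first three minors are squares that give `ab =
  -- ac = bc = 0`. The last two exclude a single nonzero entry; both are needed, since row 3 misses
  -- `c` and row 4 misses `b`.
  have h12 := det_submatrix_eq_zero h ![0, 1, 3, 4] ![0, 1, 3, 4]
  have h13 := det_submatrix_eq_zero h ![0, 2, 3, 4] ![0, 2, 3, 4]
  have h23 := det_submatrix_eq_zero h ![1, 2, 3, 4] ![1, 2, 3, 4]
  have h1 := det_submatrix_eq_zero h ![0, 1, 2, 3] ![0, 1, 2, 3]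
  have h2 := det_submatrix_eq_zero h ![0, 1, 2, 4] ![0, 1, 2, 4]
  simp [blk, Matrix.det_succ_row_zero, Fin.sum_univ_succ, Fin.succAbove,
    -Matrix.submatrix_cons_row] at h12 h13 h23 h1 h2
  grind

/-- The entries of the Schur complement of the lower right block satisfy the equations of a
symmetric matrix of rank at most one. -/
theorem blk_minors (h : (blk t ![1, a, b, c]).rank ≤ 3) :
    let P (x : K) := 3 * t - 16 * x ^ 2
    let Q (x y z : K) := 24 * x + 8 * y * z
    P a * P b = Q c a b ^ 2 ∧ P a * P c = Q b a c ^ 2 ∧ P b * P c = Q a b c ^ 2 ∧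
      P a * Q a b c = Q b a c * Q c a b ∧ P b * Q b a c = Q a b c * Q c a b ∧
      P c * Q c a b = Q a b c * Q b a c := by
  have h1 := det_submatrix_eq_zero h ![0, 1, 3, 4] ![0, 1, 3, 4]
  have h2 := det_submatrix_eq_zero h ![0, 2, 3, 4] ![0, 2, 3, 4]
  have h3 := det_submatrix_eq_zero h ![1, 2, 3, 4] ![1, 2, 3, 4]
  have h4 := det_submatrix_eq_zero h ![0, 1, 3, 4] ![0, 2, 3, 4]
  have h5 := det_submatrix_eq_zero h ![1, 0, 3, 4] ![1, 2, 3, 4]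
  have h6 := det_submatrix_eq_zero h ![2, 0, 3, 4] ![2, 1, 3, 4]
  simp [blk, Matrix.det_succ_row_zero, Fin.sum_univ_succ, Fin.succAbove,
    -Matrix.submatrix_cons_row] at h1 h2 h3 h4 h5 h6
  refine ⟨?_, ?_, ?_, ?_, ?_, ?_⟩
  -- Each 4 × 4 minor is the determinant 192 of the lower block times a 2 × 2 minor of the Schur
  -- complement. `P` and `Q` are 3 times its entries, which gives the factor `9 / 192`.
  · linear_combination (3 / 64) * h1
  · linear_combination (3 / 64) * h2
  · linear_combination (3 / 64) * h3
  · linear_combination (3 / 64) * h4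
  · linear_combination (3 / 64) * h5
  · linear_combination (3 / 64) * h6

/-- Suitable combinations of the minors split off `a² - b²` and `a² - c²`. If neither vanishes, both
cofactors do, and their difference is `8(b² - c²)`. -/
theorem blk_sq_eq (h : (blk t ![1, a, b, c]).rank ≤ 3) :
    a ^ 2 = b ^ 2 ∨ a ^ 2 = c ^ 2 ∨ b ^ 2 = c ^ 2 := by
  obtain ⟨-, -, -, h1, h2, h3⟩ := blk_minors h
  dsimp only at h1 h2 h3
  have k1 : (a ^ 2 - b ^ 2) * (3 * t - 8 * (2 * a ^ 2 + 2 * b ^ 2 + c ^ 2) - 8 * (a * b * c)) =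
      0 := by
    linear_combination (1 / 24) * a * h1 - (1 / 24) * b * h2
  have k2 : (a ^ 2 - c ^ 2) * (3 * t - 8 * (2 * a ^ 2 + b ^ 2 + 2 * c ^ 2) - 8 * (a * b * c)) =
      0 := by
    linear_combination (1 / 24) * a * h1 - (1 / 24) * c * h3
  rcases mul_eq_zero.1 k1 with k1 | k1
  · exact .inl (sub_eq_zero.1 k1)
  rcases mul_eq_zero.1 k2 with k2 | k2
  · exact .inr (.inl (sub_eq_zero.1 k2))
  · exact .inr (.inr (by linear_combination (1 / 8) * k2 - (1 / 8) * k1))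

theorem blk_symmetric (h0 : t ≠ 0) (h12 : t ≠ 12) (h48 : t ≠ 48)
    (h : (blk t ![1, a, a, c]).rank ≤ 3) :
    (c = a ∧ 8 * a ^ 2 + 8 * a = t) ∨ (c = -a ∧ 8 * a ^ 2 - 8 * a = t) ∨
      (a ^ 2 = 3 - 2 * c ∧ t = 24 - 8 * c) := by
  obtain ⟨e1, e2, -, e4, -, e6⟩ := blk_minors h
  dsimp only at e1 e2 e4 e6
  -- For `b = a` both sides of `e4` share the factor `Q a a c = 8a(3 + c)`. Its vanishing leads to
  -- `t = 0`, `12` or `48`.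
  have k : a * (3 + c) * (t - 8 * a ^ 2 - 8 * c) = 0 := by
    linear_combination (1 / 24) * e4
  rcases mul_eq_zero.1 k with k | k
  · exfalso
    rcases mul_eq_zero.1 k with k | k
    · subst k
      have hc : 3 * t = 16 * c ^ 2 := by
        have : t * (3 * t - 16 * c ^ 2) = 0 := by linear_combination (1 / 3) * e2
        exact sub_eq_zero.1 ((mul_eq_zero.1 this).resolve_left h0)
      have : t * (t - 12) = 0 := by linear_combination (1 / 9) * e1 - 4 * hc
      exact (mul_eq_zero.1 this).elim h0 fun h => h12 (sub_eq_zero.1 h)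
    · obtain rfl : c = -3 := by linear_combination k
      grind
  · have ht : t = 8 * a ^ 2 + 8 * c := by linear_combination k
    subst ht
    have : (c - a) * (c + a) * (a ^ 2 + 2 * c - 3) = 0 := by
      linear_combination -(1 / 192) * e2
    rcases mul_eq_zero.1 this with h | h
    · rcases mul_eq_zero.1 h with h | h
      · left; grind
      · right; left; grind
    · right; right; grind

end

/-- The points of the orbits of length four. -/
def star {R : Type*} [CommRing R] (a : R) (i : Fin 4) : Fin 4 → R :=
  fun k => if k = i then 1 + 3 * a else 1 - a

/-- The points of the orbit of length twelve. -/
def pairPt {R : Type*} [CommRing R] (a c : R) (i j : Fin 4) : Fin 4 → R :=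
  fun k => if k = i then 1 + 2 * a + c else if k = j then 1 - 2 * a + c else 1 - c

theorem star_perm {R : Type*} [CommRing R] (a : R) (i : Fin 4) (σ : Equiv.Perm (Fin 4)) :
    (fun k => star a i (σ⁻¹ k)) = star a (σ i) := by
  ext k
  simp only [star, Equiv.Perm.inv_eq_iff_eq]

theorem pairPt_perm {R : Type*} [CommRing R] (a c : R) (i j : Fin 4) (σ : Equiv.Perm (Fin 4)) :
    (fun k => pairPt a c i j (σ⁻¹ k)) = pairPt a c (σ i) (σ j) := by
  ext k
  simp only [pairPt, Equiv.Perm.inv_eq_iff_eq]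

theorem had_had {R : Type*} [CommRing R] (x : Fin 4 → R) : had (had x) = (4 : R) • x := by
  ext i
  fin_cases i <;> simp [had] <;> ring

theorem had_diag {R : Type*} [CommRing R] (a : R) : had ![1, a, a, a] = star a 0 := by
  ext i
  fin_cases i <;> simp [had, star]
  ring

theorem had_pair {R : Type*} [CommRing R] (a c : R) : had ![1, a, a, c] = pairPt a c 0 3 := by
  ext i
  fin_cases i <;> simp [had, pairPt] <;> ring

section

variable {K : Type*} [Field K] [CharZero K] {t : K} {x : Fin 4 → K}

theorem exists_had (x : Fin 4 → K) :
    ∃ a b c : K, x = had ![(∑ i, x i) / 4, a, b, c] := by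
  have h : x = had ((4 : K)⁻¹ • had x) := by
    have : had ((4 : K)⁻¹ • had x) = (4 : K)⁻¹ • had (had x) := by
      ext i
      fin_cases i <;> simp [had] <;> ring
    rw [this, had_had, smul_smul, inv_mul_cancel₀ (four_ne_zero_of_charZero K), one_smul]
  refine ⟨4⁻¹ * had x 1, 4⁻¹ * had x 2, 4⁻¹ * had x 3, h.trans (congrArg had ?_)⟩
  ext i
  fin_cases i <;> simp [had, Fin.sum_univ_four]
  ring

theorem eq_zero_of_sum_eq_zero (hr : (pencil t x).rank ≤ 3) (hs : ∑ i, x i = 0) : x = 0 := by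
  obtain ⟨a, b, c, h⟩ := exists_had x
  rw [hs, zero_div] at h
  rw [h, rank_pencil_had] at hr
  obtain ⟨rfl, rfl, rfl⟩ := blk_infinity hr
  rw [h]
  ext i
  fin_cases i <;> simp [had]

/-- In Hadamard coordinates each equality `a = ±b`, `a = ±c`, `b = ±c` is an equality of two
coordinates of `x`. -/
theorem exists_coord_eq (hr : (pencil t x).rank ≤ 3) (hs : ∑ i, x i = 4) :
    ∃ i j, i ≠ j ∧ x i = x j := by
  obtain ⟨a, b, c, h⟩ := exists_had x
  rw [hs, div_self (four_ne_zero_of_charZero K)] at h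
  rw [h, rank_pencil_had] at hr
  have := blk_sq_eq hr
  simp only [sq_eq_sq_iff_eq_or_eq_neg] at this
  rcases this with (rfl | rfl) | (rfl | rfl) | (rfl | rfl)
  · exact ⟨1, 2, by decide, by rw [h]; simp [had]⟩
  · exact ⟨0, 3, by decide, by rw [h]; simp [had]⟩
  · exact ⟨1, 3, by decide, by rw [h]; simp [had]; ring⟩
  · exact ⟨0, 2, by decide, by rw [h]; simp [had]; ring⟩
  · exact ⟨2, 3, by decide, by rw [h]; simp [had]⟩
  · exact ⟨0, 1, by decide, by rw [h]; simp [had]⟩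

theorem exists_perm_apply (i j : Fin 4) (h : i ≠ j) :
    ∃ σ : Equiv.Perm (Fin 4), σ 1 = i ∧ σ 2 = j := by
  revert i j; decide

/-- Up to scaling, the points of rank at most three are the points `star a i` and
`pairPt a c i j`. -/
theorem eq_star_or_pairPt (h0 : t ≠ 0) (h12 : t ≠ 12) (h48 : t ≠ 48)
    (hr : (pencil t x).rank ≤ 3) (hs : ∑ i, x i = 4) :
    (∃ a i, 8 * a ^ 2 + 8 * a = t ∧ x = star a i) ∨
      ∃ a c i j, i ≠ j ∧ a ^ 2 = 3 - 2 * c ∧ t = 24 - 8 * c ∧ x = pairPt a c i j := by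
  obtain ⟨i, j, hij, hx⟩ := exists_coord_eq hr hs
  -- The equal coordinates are moved to positions 1 and 2, because `y 1 - y 2 = 2(a - b)`.
  obtain ⟨σ, rfl, rfl⟩ := exists_perm_apply i j hij
  obtain ⟨y, hy⟩ : ∃ y : Fin 4 → K, y = fun k => x (σ k) := ⟨_, rfl⟩
  have hxy : x = fun k => y (σ⁻¹ k) := by ext k; simp [hy]
  have hy12 : y 1 = y 2 := by rw [hy]; exact hx
  have hys : ∑ i, y i = 4 := by rw [hy, Equiv.sum_comp σ x, hs]
  rw [hxy, rank_pencil_perm] at hr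
  obtain ⟨a, b, c, h⟩ := exists_had y
  rw [hys, div_self (four_ne_zero_of_charZero K)] at h
  obtain rfl : a = b := by
    have : y 1 = 1 + a - b - c ∧ y 2 = 1 - a + b - c := by rw [h]; simp [had]
    linear_combination (1 / 2) * (hy12 - this.1 + this.2)
  rw [h, rank_pencil_had] at hr
  rcases blk_symmetric h0 h12 h48 hr with ⟨rfl, ht⟩ | ⟨rfl, ht⟩ | ⟨hac, ht⟩
  · exact .inl ⟨c, σ 0, ht, by rw [hxy, h, had_diag, star_perm]⟩
  · refine .inl ⟨-a, σ 3, by rw [← ht]; ring, ?_⟩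
    have : had ![1, a, a, -a] = star (-a) 3 := by
      ext i
      fin_cases i <;> simp [had, star]
      ring
    rw [hxy, h, this, star_perm]
  · exact .inr ⟨a, c, σ 0, σ 3, by simp, hac, ht, by rw [hxy, h, had_pair, pairPt_perm]⟩

end

/-! ### Normal forms of the matrices of rank three -/

/-- A symmetric `3 × 3` matrix which is definite or indefinite according to the sign of `p`. -/
def coreMatrix {R : Type*} [CommRing R] (p : R) : Matrix (Fin 3) (Fin 3) R :=
  !![16, 8, 0; 8, 16, 0; 0, 0, p]

/-- `A` is congruent to the direct sum of `coreMatrix p` and a zero matrix. -/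
def HasCore {K : Type*} [Field K] (A : Matrix (Fin 5) (Fin 5) K) (p : K) : Prop :=
  ∃ (M : Matrix (Fin 5) (Fin 3) K) (N : Matrix (Fin 3) (Fin 5) K),
    N * M = 1 ∧ A = M * coreMatrix p * M.transpose

section

variable {K : Type*} [Field K] {A : Matrix (Fin 5) (Fin 5) K} {p t a c : K}

theorem HasCore.exists_eq (h : HasCore A p) :
    ∃ N : Matrix (Fin 3) (Fin 5) K, coreMatrix p = N * A * N.transpose := by
  obtain ⟨M, N, hNM, rfl⟩ := h
  refine ⟨N, ?_⟩
  calc coreMatrix p = (N * M) * coreMatrix p * (N * M).transpose := by rw [hNM]; simp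
    _ = _ := by rw [Matrix.transpose_mul]; simp only [Matrix.mul_assoc]

theorem HasCore.congr (h : HasCore A p) {R : Matrix (Fin 5) (Fin 5) K} (hR : IsUnit R) :
    HasCore (R * A * R.transpose) p := by
  obtain ⟨M, N, hNM, rfl⟩ := h
  refine ⟨R * M, N * R⁻¹, ?_, ?_⟩
  · rw [Matrix.mul_assoc, Matrix.nonsing_inv_mul_cancel_left _ _
      ((Matrix.isUnit_iff_isUnit_det _).1 hR), hNM]
  · rw [Matrix.transpose_mul]; simp only [Matrix.mul_assoc]

theorem rank_coreMatrix [CharZero K] (hp : p ≠ 0) : (coreMatrix p).rank = 3 := by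
  have h : (coreMatrix p).det ≠ 0 := by
    have : (coreMatrix p).det = 192 * p := by
      simp [coreMatrix, Matrix.det_fin_three]
      ring
    rw [this]
    exact mul_ne_zero (by norm_num) hp
  rw [Matrix.rank_of_isUnit _ ((Matrix.isUnit_iff_isUnit_det _).2 h.isUnit), Fintype.card_fin]

theorem HasCore.rank_eq [CharZero K] (h : HasCore A p) (hp : p ≠ 0) : A.rank = 3 := by
  apply le_antisymm
  · obtain ⟨M, N, -, rfl⟩ := h
    rw [Matrix.mul_assoc]
    exact (Matrix.rank_mul_le_left _ _).trans (Matrix.rank_le_width M)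
  · obtain ⟨N, hN⟩ := h.exists_eq
    rw [← rank_coreMatrix hp, hN]
    exact (Matrix.rank_mul_le_left _ _).trans (Matrix.rank_mul_le_right _ _)

theorem isUnit_two_smul_framing [CharZero K] : IsUnit ((2 : K) • framing K) := by
  rw [Matrix.isUnit_iff_isUnit_det, Matrix.det_smul, det_framing, isUnit_iff_ne_zero]
  simp

theorem pencil_had_eq_congr (t : K) (z : Fin 4 → K) : pencil t (had z) =
    ((2 : K) • framing K) * blk t z * ((2 : K) • framing K).transpose := by
  rw [pencil_had, Matrix.transpose_smul, Matrix.smul_mul, Matrix.smul_mul, Matrix.mul_smul,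
    smul_smul]
  norm_num

theorem HasCore.pencil_had [CharZero K] {z : Fin 4 → K} (h : HasCore (blk t z) p) :
    HasCore (pencil t (had z)) p := by
  rw [pencil_had_eq_congr]
  exact h.congr isUnit_two_smul_framing

theorem HasCore.pencil_perm {x : Fin 4 → K} (h : HasCore (pencil t x) p)
    (σ : Equiv.Perm (Fin 4)) : HasCore (pencil t fun k => x (σ⁻¹ k)) p := by
  rw [pencil_equivariant]
  exact h.congr (isUnit_rep σ)

/-- If the Schur complement of the lower right block is `p` times the square of the vector
`(1, v, w)`, then `blk` has core `p`. -/
theorem hasCore_blk [CharZero K] {b d : K} (v w : K) (h00 : 3 * t - 16 * a ^ 2 = 3 * p)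
    (h11 : 3 * t - 16 * b ^ 2 = 3 * (p * v ^ 2)) (h22 : 3 * t - 16 * d ^ 2 = 3 * (p * w ^ 2))
    (h01 : 24 * d + 8 * a * b = 3 * (p * v)) (h02 : 24 * b + 8 * a * d = 3 * (p * w))
    (h12 : 24 * a + 8 * b * d = 3 * (p * (v * w))) :
    HasCore (blk t ![1, a, b, d]) p := by
  -- Block Cholesky factorization: the first two columns hold the off-diagonal block times the
  -- inverse of the lower block, above the identity; the third column is `(1, v, w, 0, 0)`.
  refine ⟨!![a / 3, a / 3, 1; -(2 * b) / 3, b / 3, v; d / 3, -(2 * d) / 3, w;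
      1, 0, 0; 0, 1, 0], !![0, 0, 0, 1, 0; 0, 0, 0, 0, 1; 1, 0, 0, -(a / 3), -(a / 3)], ?_, ?_⟩
  · ext i j
    fin_cases i <;> fin_cases j <;> simp [Matrix.mul_apply, Fin.sum_univ_five]
  · have h : blk t ![1, a, b, d] =
        !![16 / 3 * a ^ 2 + p, 8 * d, 8 * b, 8 * a, 8 * a;
          8 * d, 16 / 3 * b ^ 2 + p * v ^ 2, 8 * a, -8 * b, 0;
          8 * b, 8 * a, 16 / 3 * d ^ 2 + p * w ^ 2, 0, -8 * d;
          8 * a, -8 * b, 0, 16, 8; 8 * a, 0, -8 * d, 8, 16] := by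
      rw [← show t = 16 / 3 * a ^ 2 + p by linear_combination h00 / 3,
        ← show t = 16 / 3 * b ^ 2 + p * v ^ 2 by linear_combination h11 / 3,
        ← show t = 16 / 3 * d ^ 2 + p * w ^ 2 by linear_combination h22 / 3]
      simp [blk]
    rw [h]
    ext i j
    simp only [Matrix.mul_apply, Fin.sum_univ_three, Matrix.transpose_apply]
    fin_cases i <;> fin_cases j <;> simp [coreMatrix] <;>
      first
      | ring1
      | linear_combination h01 / 3
      | linear_combination h02 / 3
      | linear_combination h12 / 3

/-- All entries of the Schur complement equal `p = t - 16a²/3`, so the vector is `(1, 1, 1)`. -/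
theorem hasCore_star [CharZero K] (a : K) (i : Fin 4) :
    HasCore (pencil (8 * a ^ 2 + 8 * a) (star a i)) (8 / 3 * (a * (a + 3))) := by
  have h : HasCore (pencil (8 * a ^ 2 + 8 * a) (star a 0)) (8 / 3 * (a * (a + 3))) := by
    rw [← had_diag]
    apply HasCore.pencil_had
    apply hasCore_blk 1 1 <;> ring
  simpa only [star_perm, Equiv.swap_apply_left] using h.pencil_perm (Equiv.swap 0 i)

theorem exists_perm_apply_zero_three (i j : Fin 4) (h : i ≠ j) :
    ∃ σ : Equiv.Perm (Fin 4), σ 0 = i ∧ σ 3 = j := by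
  revert i j; decide

/-- Here the Schur complement is `p` times the square of `(1, 1, a)`, with `p = t - 16a²/3`
rewritten by `a² = 3 - 2c`. -/
theorem hasCore_pairPt [CharZero K] (hac : a ^ 2 = 3 - 2 * c) {i j : Fin 4} (hij : i ≠ j) :
    HasCore (pencil (24 - 8 * c) (pairPt a c i j)) (8 / 3 * (c + 3)) := by
  have h : HasCore (pencil (24 - 8 * c) (pairPt a c 0 3)) (8 / 3 * (c + 3)) := by
    rw [← had_pair]
    apply HasCore.pencil_had
    refine hasCore_blk 1 a ?_ ?_ ?_ ?_ ?_ ?_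
    · linear_combination -16 * hac
    · linear_combination -16 * hac
    · linear_combination -8 * (c + 3) * hac
    · linear_combination 8 * hac
    · ring
    · ring
  obtain ⟨σ, rfl, rfl⟩ := exists_perm_apply_zero_three i j hij
  simpa only [pairPt_perm] using h.pencil_perm σ

end

theorem posSemidef_coreMatrix {p : ℝ} (hp : 0 ≤ p) : (coreMatrix p).PosSemidef := by
  refine Matrix.PosSemidef.of_dotProduct_mulVec_nonneg ?_ fun x => ?_
  · ext i j
    fin_cases i <;> fin_cases j <;> simp [coreMatrix]
  · simp [coreMatrix, Matrix.mulVec, dotProduct, Fin.sum_univ_three]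
    nlinarith [sq_nonneg (x 0 + x 1), sq_nonneg (x 0), sq_nonneg (x 1),
      mul_nonneg hp (sq_nonneg (x 2))]

/-- Semidefiniteness passes to the core, whose diagonal contains `16` and `p`: the `16` rules out
the negative sign, and then `p` must be nonnegative. -/
theorem HasCore.posSemidef_iff {A : Matrix (Fin 5) (Fin 5) ℝ} {p : ℝ} (h : HasCore A p) :
    A.PosSemidef ∨ (-A).PosSemidef ↔ 0 ≤ p := by
  constructor
  · obtain ⟨N, hN⟩ := h.exists_eq
    rintro (hA | hA)
    · have := (hA.mul_mul_conjTranspose_same N).diag_nonneg (i := 2)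
      rw [Matrix.conjTranspose_eq_transpose_of_trivial, ← hN] at this
      simpa [coreMatrix] using this
    · have := (hA.mul_mul_conjTranspose_same N).diag_nonneg (i := 0)
      rw [Matrix.conjTranspose_eq_transpose_of_trivial, Matrix.mul_neg, Matrix.neg_mul,
        ← hN] at this
      simp [coreMatrix] at this
      linarith
  · intro hp
    obtain ⟨M, N, -, rfl⟩ := h
    have := (posSemidef_coreMatrix hp).mul_mul_conjTranspose_same M
    rw [Matrix.conjTranspose_eq_transpose_of_trivial] at this
    exact .inl this

/-! ### Negative parameters -/

theorem eq_zero_of_posSemidef_blk {t : ℝ} (ht : t < 0) {z : Fin 4 → ℝ}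
    (h : (blk t z).PosSemidef) : z = 0 := by
  have h0 : z 0 = 0 := by
    have h1 := h.diag_nonneg (i := 0)
    have h2 := h.diag_nonneg (i := 3)
    simp [blk] at h1 h2
    nlinarith
  -- The diagonal is now zero, so these vectors make the quadratic form equal to `-16 * z k ^ 2` for
  -- `k = 1, 2, 3`.
  have h1 := h.dotProduct_mulVec_nonneg ![-z 1, 0, 0, 1, 0]
  have h2 := h.dotProduct_mulVec_nonneg ![0, z 2, 0, 1, 0]
  have h3 := h.dotProduct_mulVec_nonneg ![0, 0, z 3, 0, 1]
  simp [blk, h0, Matrix.mulVec, dotProduct, Fin.sum_univ_five] at h1 h2 h3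
  ext i
  fin_cases i
  · exact h0
  all_goals
    refine mul_self_eq_zero.1 (le_antisymm ?_ (mul_self_nonneg _))
    simp only [Fin.mk_one, Fin.reduceFinMk]
    linarith

theorem eq_zero_of_posSemidef_pencil {t : ℝ} (ht : t < 0) {x : Fin 4 → ℝ}
    (h : (pencil t x).PosSemidef) : x = 0 := by
  obtain ⟨z, rfl⟩ : ∃ z, x = had z := let ⟨_, _, _, h⟩ := exists_had x; ⟨_, h⟩
  rw [pencil_had_eq_congr, ← Matrix.conjTranspose_eq_transpose_of_trivial] at h
  have hz : z = 0 := eq_zero_of_posSemidef_blk ht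
    ((Matrix.IsUnit.posSemidef_star_right_conjugate_iff isUnit_two_smul_framing).1 h)
  rw [hz]
  ext i
  fin_cases i <;> simp [had]

theorem spectrahedron_eq_empty {t : ℝ} (ht : t < 0) : spectrahedron t = ∅ := by
  refine Set.eq_empty_iff_forall_notMem.2 fun q hq => ?_
  rcases hq with h | h
  · exact q.rep_nonzero (eq_zero_of_posSemidef_pencil ht h)
  · refine neg_ne_zero.2 q.rep_nonzero (eq_zero_of_posSemidef_pencil ht ?_)
    rwa [← neg_one_smul ℝ q.rep, pencil_smul, neg_one_smul]

/-! ### Points of projective space with coordinate sum four -/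

theorem ne_zero_of_sum {K : Type*} [Field K] [CharZero K] {x : Fin 4 → K}
    (h : ∑ i, x i = 4) : x ≠ 0 := by
  rintro rfl
  simp at h

/-- The point with the homogeneous coordinates `x`, which are normalized by their sum. -/
noncomputable def affinePoint (x : Fin 4 → ℂ) (h : ∑ i, x i = 4) : CP3 :=
  Projectivization.mk ℂ x (ne_zero_of_sum h)

theorem affinePoint_inj {x y : Fin 4 → ℂ} {hx : ∑ i, x i = 4} {hy : ∑ i, y i = 4} :
    affinePoint x hx = affinePoint y hy ↔ x = y := by
  refine ⟨fun h => ?_, fun h => by subst h; rfl⟩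
  obtain ⟨a, rfl⟩ := (Projectivization.mk_eq_mk_iff' ..).1 h
  simp only [Pi.smul_apply, smul_eq_mul, ← Finset.mul_sum, hy] at hx
  rw [show a = 1 by linear_combination hx / 4, one_smul]

theorem sum_perm {x : Fin 4 → ℂ} (h : ∑ i, x i = 4) (σ : Equiv.Perm (Fin 4)) :
    ∑ i, x (σ⁻¹ i) = 4 := by
  rw [Equiv.sum_comp, h]

theorem permPoint_affinePoint (σ : Equiv.Perm (Fin 4)) {x : Fin 4 → ℂ} (h : ∑ i, x i = 4) :
    permPoint σ (affinePoint x h) = affinePoint (fun i => x (σ⁻¹ i)) (sum_perm h σ) :=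
  rfl

theorem exists_rep_affinePoint (x : Fin 4 → ℂ) (h : ∑ i, x i = 4) :
    ∃ c : ℂ, c ≠ 0 ∧ (affinePoint x h).rep = c • x := by
  obtain ⟨c, hc⟩ := Projectivization.exists_smul_eq_mk_rep ℂ x (ne_zero_of_sum h)
  exact ⟨c, c.ne_zero, hc.symm⟩

theorem rank_pencil_rep (t : ℂ) (x : Fin 4 → ℂ) (h : ∑ i, x i = 4) :
    (pencil t (affinePoint x h).rep).rank = (pencil t x).rank := by
  obtain ⟨c, hc, hr⟩ := exists_rep_affinePoint x h
  rw [hr, pencil_smul, Matrix.rank_smul_of_mem_nonZeroDivisors _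
    (mem_nonZeroDivisors_of_ne_zero hc)]

theorem mem_nodes_affinePoint {t : ℝ} {x : Fin 4 → ℂ} {h : ∑ i, x i = 4} :
    affinePoint x h ∈ nodes t ↔ (pencil (t : ℂ) x).rank ≤ 3 := by
  rw [nodes, Set.mem_ofPred_eq, rank_pencil_rep]

theorem exists_affinePoint_of_mem_nodes {t : ℝ} {p : CP3} (hp : p ∈ nodes t) :
    ∃ x h, p = affinePoint x h := by
  have hs : ∑ i, p.rep i ≠ 0 := fun h => p.rep_nonzero (eq_zero_of_sum_eq_zero hp h)
  refine ⟨(4 / ∑ i, p.rep i) • p.rep, ?_, ?_⟩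
  · simp only [Pi.smul_apply, smul_eq_mul, ← Finset.mul_sum]
    exact div_mul_cancel₀ _ hs
  · conv_lhs => rw [← p.mk_rep]
    refine ((Projectivization.mk_eq_mk_iff' ..).2 ⟨(∑ i, p.rep i) / 4, ?_⟩)
    rw [smul_smul, div_mul_div_cancel₀ (by norm_num : (4 : ℂ) ≠ 0), div_self hs, one_smul]

theorem isNode_affinePoint {t : ℝ} {x : Fin 4 → ℂ} (h : ∑ i, x i = 4)
    (hx : NodeAt (symmetroidForm t) x) : IsNode (symmetroidForm t) (affinePoint x h) := by
  obtain ⟨c, hc, hr⟩ := exists_rep_affinePoint x h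
  have := hx.smul hc
  rw [← hr] at this
  exact this

/-- A real representative differs from `x` by a scalar, which is the quotient of the coordinate
sums; as `x` has sum 4, this scalar is real and `x` itself would be real. -/
theorem isNonreal_affinePoint {x : Fin 4 → ℂ} (h : ∑ i, x i = 4) (k : Fin 4)
    (hk : (x k).im ≠ 0) : IsNonreal (affinePoint x h) := by
  rintro ⟨q, hq⟩
  have hq' : toComplex q = Projectivization.mk ℂ (complexify q.rep)
      (map_zero complexify ▸ complexify_injective.ne q.rep_nonzero) := by
    conv_lhs => rw [← q.mk_rep]
    rfl
  obtain ⟨a, ha⟩ := (Projectivization.mk_eq_mk_iff' ..).1 (hq.symm.trans hq')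
  have ha' : ∀ i, x i = a * (q.rep i : ℂ) := fun i => (congrFun ha i).symm
  simp only [ha', ← Finset.mul_sum] at h
  have ha0 : a = ((4 / ∑ i, q.rep i : ℝ) : ℂ) := by
    push_cast
    rw [eq_div_iff, h]
    intro h0
    simp [h0] at h
  apply hk
  rw [ha', ha0, ← Complex.ofReal_mul, Complex.ofReal_im]

theorem posSemidef_smul_iff {A : Matrix (Fin 5) (Fin 5) ℝ} {c : ℝ} (hc : c ≠ 0) :
    (c • A).PosSemidef ∨ (-(c • A)).PosSemidef ↔ A.PosSemidef ∨ (-A).PosSemidef := by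
  have key : ∀ (B : Matrix (Fin 5) (Fin 5) ℝ) (d : ℝ), d ≠ 0 → B.PosSemidef ∨ (-B).PosSemidef →
      (d • B).PosSemidef ∨ (-(d • B)).PosSemidef := by
    intro B d hd h
    rcases hd.lt_or_gt with hd | hd
    · have e : d • B = (-d) • (-B) := by simp
      have e' : -(d • B) = (-d) • B := by simp
      rw [e', e]
      exact h.symm.imp (·.smul (neg_nonneg.2 hd.le)) (·.smul (neg_nonneg.2 hd.le))
    · rw [← smul_neg]
      exact h.imp (·.smul hd.le) (·.smul hd.le)
  refine ⟨fun h => ?_, key A c hc⟩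
  have := key _ c⁻¹ (inv_ne_zero hc) h
  rwa [smul_smul, inv_mul_cancel₀ hc, one_smul] at this

theorem mem_spectrahedron_mk {t p : ℝ} {y : Fin 4 → ℝ} (hy : y ≠ 0)
    (h : HasCore (pencil t y) p) : Projectivization.mk ℝ y hy ∈ spectrahedron t ↔ 0 ≤ p := by
  obtain ⟨c, hc⟩ := Projectivization.exists_smul_eq_mk_rep ℝ y hy
  rw [spectrahedron, Set.mem_ofPred_eq, ← hc, Units.smul_def, pencil_smul,
    posSemidef_smul_iff c.ne_zero, h.posSemidef_iff]

theorem sum_complexify {y : Fin 4 → ℝ} (h : ∑ i, y i = 4) : ∑ i, complexify y i = 4 := by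
  have := congrArg (Complex.ofReal) h
  simpa [complexify] using this

theorem toComplex_mk {y : Fin 4 → ℝ} (h : ∑ i, y i = 4) :
    toComplex (Projectivization.mk ℝ y (ne_zero_of_sum h)) =
      affinePoint (complexify y) (sum_complexify h) :=
  rfl

theorem isRealSemidefinite_affinePoint {t p : ℝ} {y : Fin 4 → ℝ} (h : ∑ i, y i = 4)
    (hc : HasCore (pencil t y) p) (hp : 0 ≤ p) :
    IsRealSemidefinite t (affinePoint (complexify y) (sum_complexify h)) :=
  ⟨_, toComplex_mk h, (mem_spectrahedron_mk _ hc).2 hp⟩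

theorem isRealIndefinite_affinePoint {t p : ℝ} {y : Fin 4 → ℝ} (h : ∑ i, y i = 4)
    (hc : HasCore (pencil t y) p) (hp : p < 0) :
    IsRealIndefinite t (affinePoint (complexify y) (sum_complexify h)) :=
  ⟨_, toComplex_mk h, fun hm => hp.not_ge ((mem_spectrahedron_mk _ hc).1 hm)⟩

/-! ### The three orbits -/

theorem sum_star {R : Type*} [CommRing R] (a : R) (i : Fin 4) : ∑ k, star a i k = 4 := by
  fin_cases i <;> simp [star, Fin.sum_univ_four] <;> ring

theorem sum_pairPt {R : Type*} [CommRing R] (a c : R) {i j : Fin 4} (h : i ≠ j) :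
    ∑ k, pairPt a c i j k = 4 := by
  fin_cases i <;> fin_cases j <;> simp [pairPt, Fin.sum_univ_four] at h ⊢ <;> ring

/-- The point of projective space represented by `star a i`. -/
noncomputable def starPoint (a : ℂ) (i : Fin 4) : CP3 := affinePoint (star a i) (sum_star a i)

/-- The point of projective space represented by `pairPt a c i j`. -/
noncomputable def pairPoint (a c : ℂ) (q : {q : Fin 4 × Fin 4 // q.1 ≠ q.2}) : CP3 :=
  affinePoint (pairPt a c q.1.1 q.1.2) (sum_pairPt a c q.2)

theorem permPoint_starPoint (σ : Equiv.Perm (Fin 4)) (a : ℂ) (i : Fin 4) :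
    permPoint σ (starPoint a i) = starPoint a (σ i) := by
  rw [starPoint, permPoint_affinePoint, starPoint, affinePoint_inj, star_perm]

theorem permPoint_pairPoint (σ : Equiv.Perm (Fin 4)) (a c : ℂ)
    (q : {q : Fin 4 × Fin 4 // q.1 ≠ q.2}) :
    permPoint σ (pairPoint a c q) = pairPoint a c ⟨(σ q.1.1, σ q.1.2), by simpa using q.2⟩ := by
  rw [pairPoint, permPoint_affinePoint, pairPoint, affinePoint_inj, pairPt_perm]

theorem isS4Orbit_range_starPoint (a : ℂ) : IsS4Orbit (Set.range (starPoint a)) := by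
  refine ⟨starPoint a 0, Set.Subset.antisymm ?_ ?_⟩
  · rintro _ ⟨i, rfl⟩
    exact ⟨Equiv.swap 0 i, by simp [permPoint_starPoint]⟩
  · rintro _ ⟨σ, rfl⟩
    exact ⟨σ 0, (permPoint_starPoint ..).symm⟩

theorem isS4Orbit_range_pairPoint (a c : ℂ) : IsS4Orbit (Set.range (pairPoint a c)) := by
  refine ⟨pairPoint a c ⟨(0, 3), by decide⟩, Set.Subset.antisymm ?_ ?_⟩
  · rintro _ ⟨⟨⟨i, j⟩, hij⟩, rfl⟩
    obtain ⟨σ, rfl, rfl⟩ := exists_perm_apply_zero_three i j hij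
    exact ⟨σ, permPoint_pairPoint ..⟩
  · rintro _ ⟨σ, rfl⟩
    exact ⟨_, (permPoint_pairPoint ..).symm⟩

theorem encard_range_starPoint {a : ℂ} (h : a ≠ 0) : (Set.range (starPoint a)).encard = 4 := by
  have hinj : Function.Injective (starPoint a) := by
    intro i j hij
    by_contra hne
    have := congrFun (affinePoint_inj.1 hij) i
    simp only [star, if_true, if_neg hne] at this
    exact h (by linear_combination this / 4)
  rw [← Set.image_univ, hinj.encard_image, Set.encard_univ]
  simp

/-- The three hypotheses say that the values at `i`, at `j` and elsewhere are distinct, so the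
ordered pair can be read off from the point. -/
theorem encard_range_pairPoint {a c : ℂ} (ha : a ≠ 0) (hs : a + c ≠ 0) (hd : a - c ≠ 0) :
    (Set.range (pairPoint a c)).encard = 12 := by
  have hinj : Function.Injective (pairPoint a c) := by
    rintro ⟨⟨i, j⟩, hij⟩ ⟨⟨k, l⟩, hkl⟩ h
    replace h := affinePoint_inj.1 h
    have h1 := congrFun h k
    have h2 := congrFun h l
    simp only [pairPt, if_true, if_neg hkl.symm] at h1 h2
    have : k = i := by
      by_contra hk
      rw [if_neg hk] at h1
      split_ifs at h1
      · exact ha (by linear_combination -h1 / 4)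
      · exact hs (by linear_combination -h1 / 2)
    subst this
    have : l = j := by
      by_contra hl
      rw [if_neg hkl.symm, if_neg hl] at h2
      exact hd (by linear_combination h2 / 2)
    subst this
    rfl
  rw [← Set.image_univ, hinj.encard_image, Set.encard_univ, ENat.card_eq_coe_fintype_card]
  have : Fintype.card {q : Fin 4 × Fin 4 // q.1 ≠ q.2} = 12 := by decide
  rw [this]
  rfl

theorem disjoint_range_starPoint {a b : ℂ} (h : a ≠ b) :
    Disjoint (Set.range (starPoint a)) (Set.range (starPoint b)) := by
  rw [Set.disjoint_left]
  rintro _ ⟨i, rfl⟩ ⟨j, hij⟩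
  obtain ⟨k, hki, hkj⟩ : ∃ k, k ≠ i ∧ k ≠ j := by
    clear hij
    revert i j
    decide
  have := congrFun (affinePoint_inj.1 hij) k
  simp only [star, if_neg hki, if_neg hkj] at this
  exact h (by linear_combination this)

/-- A point of a 4-orbit has three equal coordinates, whereas the two special coordinates here both
differ from the rest. -/
theorem disjoint_range_pairPoint {a b c : ℂ} (hs : a + c ≠ 0) (hd : a - c ≠ 0) :
    Disjoint (Set.range (pairPoint a c)) (Set.range (starPoint b)) := by
  rw [Set.disjoint_left]
  rintro _ ⟨⟨⟨i, j⟩, hij⟩, rfl⟩ ⟨k, hk⟩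
  replace hk := affinePoint_inj.1 hk
  obtain ⟨l, hli, hlj, hlk⟩ : ∃ l, l ≠ i ∧ l ≠ j ∧ l ≠ k := by
    clear hk
    revert i j k
    decide
  have hi := congrFun hk i
  have hj := congrFun hk j
  have hl := congrFun hk l
  simp only [star, pairPt, if_true, if_neg hli, if_neg hlj, if_neg hlk, if_neg (Ne.symm hij)]
    at hi hj hl
  by_cases h1 : i = k
  · subst h1
    rw [if_neg (Ne.symm hij)] at hj
    exact hd (by linear_combination (hj - hl) / 2)
  · rw [if_neg h1] at hi
    exact hs (by linear_combination (hl - hi) / 2)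

theorem nodeAt_star {t : ℝ} {b : ℂ} (ht : 8 * b ^ 2 + 8 * b = t) (h2 : t ≠ -2) (h0 : t ≠ 0)
    (h16 : t ≠ 16) (h48 : t ≠ 48) (i : Fin 4) : NodeAt (symmetroidForm t) (star b i) := by
  have h : NodeAt (symmetroidForm t) (star b 0) := by
    rw [← had_diag]
    apply NodeAt.had
    rw [← ht]
    apply nodeAt_quintic_diag
    · rintro rfl
      exact h0 (by exact_mod_cast (by linear_combination -ht : (t : ℂ) = 0))
    · intro h
      exact h16 (by exact_mod_cast (by linear_combination -ht + 8 * (b + 2) * h : (t : ℂ) = 16))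
    · intro h
      exact h2 (by exact_mod_cast (by linear_combination -ht + (4 * b + 2) * h : (t : ℂ) = -2))
    · intro h
      exact h48 (by exact_mod_cast (by linear_combination -ht + 8 * (b - 2) * h : (t : ℂ) = 48))
  simpa only [star_perm, Equiv.swap_apply_left] using h.perm (Equiv.swap 0 i)

theorem nodeAt_pairPt {t : ℝ} {a c : ℂ} (hac : a ^ 2 = 3 - 2 * c) (ht : 24 - 8 * c = t)
    (h12 : t ≠ 12) (h16 : t ≠ 16) (h48 : t ≠ 48) {i j : Fin 4} (hij : i ≠ j) :
    NodeAt (symmetroidForm t) (pairPt a c i j) := by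
  have h : NodeAt (symmetroidForm t) (pairPt a c 0 3) := by
    rw [← had_pair]
    apply NodeAt.had
    rw [← ht]
    apply nodeAt_quintic_pair hac
    · rintro rfl
      exact h12 (by exact_mod_cast (by linear_combination -ht - 4 * hac : (t : ℂ) = 12))
    · intro h
      exact h16 (by exact_mod_cast (by linear_combination -ht - 8 * h : (t : ℂ) = 16))
    · intro h
      exact h48 (by exact_mod_cast (by linear_combination -ht - 8 * h : (t : ℂ) = 48))
  obtain ⟨σ, rfl, rfl⟩ := exists_perm_apply_zero_three i j hij
  simpa only [pairPt_perm] using h.perm σ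

theorem rank_pencil_star {t : ℝ} {b : ℂ} (ht : 8 * b ^ 2 + 8 * b = t) (h0 : t ≠ 0)
    (h48 : t ≠ 48) (i : Fin 4) : (pencil (t : ℂ) (star b i)).rank = 3 := by
  rw [← ht]
  refine (hasCore_star b i).rank_eq (mul_ne_zero (by norm_num) (mul_ne_zero ?_ fun h => ?_))
  · rintro rfl
    exact h0 (by exact_mod_cast (by linear_combination -ht : (t : ℂ) = 0))
  · exact h48 (by exact_mod_cast (by linear_combination -ht + 8 * (b - 2) * h : (t : ℂ) = 48))

theorem rank_pencil_pairPt {t : ℝ} {a c : ℂ} (hac : a ^ 2 = 3 - 2 * c) (ht : 24 - 8 * c = t)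
    (h48 : t ≠ 48) {i j : Fin 4} (hij : i ≠ j) :
    (pencil (t : ℂ) (pairPt a c i j)).rank = 3 := by
  rw [← ht]
  refine (hasCore_pairPt hac hij).rank_eq (mul_ne_zero (by norm_num) fun h => ?_)
  exact h48 (by exact_mod_cast (by linear_combination -ht - 8 * h : (t : ℂ) = 48))

/-- Both square roots of `3 - 2c` therefore give the same 12-orbit. -/
theorem pairPt_neg {R : Type*} [CommRing R] (a c : R) {i j : Fin 4} (h : i ≠ j) :
    pairPt (-a) c i j = pairPt a c j i := by
  ext k
  by_cases h1 : k = i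
  · subst h1; simp [pairPt, h]; ring
  · by_cases h2 : k = j
    · subst h2; simp [pairPt, h1]
    · simp [pairPt, h1, h2]

theorem nodes_eq {t : ℝ} (h0 : t ≠ 0) (h12 : t ≠ 12) (h48 : t ≠ 48) {a b₁ b₂ c : ℂ}
    (hac : a ^ 2 = 3 - 2 * c) (hct : 24 - 8 * c = t) (hb₁ : 8 * b₁ ^ 2 + 8 * b₁ = t)
    (hb : b₁ + b₂ = -1) :
    nodes t = Set.range (pairPoint a c) ∪ Set.range (starPoint b₁) ∪
      Set.range (starPoint b₂) := by
  have hb₂ : 8 * b₂ ^ 2 + 8 * b₂ = t := by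
    rw [show b₂ = -1 - b₁ by linear_combination hb, ← hb₁]
    ring
  refine Set.Subset.antisymm (fun p hp => ?_) ?_
  · obtain ⟨x, h, rfl⟩ := exists_affinePoint_of_mem_nodes hp
    rcases eq_star_or_pairPt (by exact_mod_cast h0) (by exact_mod_cast h12)
      (by exact_mod_cast h48) (mem_nodes_affinePoint.1 hp) h with
      ⟨b, i, hbt, rfl⟩ | ⟨a', c', i, j, hij, ha', hc', rfl⟩
    · have : (b - b₁) * (b - b₂) = 0 := by
        rw [show b₂ = -1 - b₁ by linear_combination hb]
        linear_combination (hbt - hb₁) / 8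
      rcases mul_eq_zero.1 this with h | h
      · exact .inl (.inr ⟨i, by rw [starPoint, affinePoint_inj, sub_eq_zero.1 h]⟩)
      · exact .inr ⟨i, by rw [starPoint, affinePoint_inj, sub_eq_zero.1 h]⟩
    · obtain rfl : c' = c := by linear_combination (hc' + hct) / 8
      refine .inl (.inl ?_)
      rcases sq_eq_sq_iff_eq_or_eq_neg.1 (ha'.trans hac.symm) with rfl | rfl
      · exact ⟨⟨(i, j), hij⟩, rfl⟩
      · exact ⟨⟨(j, i), hij.symm⟩, by rw [pairPoint, affinePoint_inj, pairPt_neg _ _ hij]⟩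
  · rintro _ ((⟨q, rfl⟩ | ⟨i, rfl⟩) | ⟨i, rfl⟩)
    · exact mem_nodes_affinePoint.2 (rank_pencil_pairPt hac hct h48 q.2).le
    · exact mem_nodes_affinePoint.2 (rank_pencil_star hb₁ h0 h48 i).le
    · exact mem_nodes_affinePoint.2 (rank_pencil_star hb₂ h0 h48 i).le

/-! ### Reality -/

theorem im_ne_zero_of_sq {z : ℂ} {r : ℝ} (h : z ^ 2 = r) (hr : r < 0) : z.im ≠ 0 := by
  intro hz
  have := congrArg Complex.re h
  simp [sq, hz] at this
  nlinarith

theorem eq_ofReal_of_sq {z : ℂ} {r : ℝ} (h : z ^ 2 = r) (hr : 0 < r) : z = (z.re : ℂ) := by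
  have h1 := congrArg Complex.re h
  have h2 := congrArg Complex.im h
  simp [sq] at h1 h2
  apply Complex.ext
  · simp
  · have : z.re ≠ 0 := by
      intro h0
      rw [h0] at h1
      nlinarith
    rw [Complex.ofReal_im]
    exact (mul_eq_zero.1 (by linear_combination h2 / 2 : z.re * z.im = 0)).resolve_left this

theorem complexify_star (b : ℝ) (i : Fin 4) : complexify (star b i) = star (b : ℂ) i := by
  ext k
  simp only [complexify, star, LinearMap.coe_mk, AddHom.coe_mk]
  split_ifs <;> push_cast <;> rfl

theorem complexify_pairPt (a c : ℝ) (i j : Fin 4) :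
    complexify (pairPt a c i j) = pairPt (a : ℂ) (c : ℂ) i j := by
  ext k
  simp only [complexify, pairPt, LinearMap.coe_mk, AddHom.coe_mk]
  split_ifs <;> push_cast <;> rfl

theorem isRealSemidefinite_starPoint {t b : ℝ} (ht : 8 * b ^ 2 + 8 * b = t)
    (hb : 0 ≤ b * (b + 3)) (i : Fin 4) : IsRealSemidefinite t (starPoint b i) := by
  have h := isRealSemidefinite_affinePoint (sum_star b i) (hasCore_star b i)
    (mul_nonneg (by norm_num) hb)
  rw [ht] at h
  convert h using 1
  rw [starPoint, affinePoint_inj, complexify_star]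

theorem isRealIndefinite_starPoint {t b : ℝ} (ht : 8 * b ^ 2 + 8 * b = t)
    (hb : b * (b + 3) < 0) (i : Fin 4) : IsRealIndefinite t (starPoint b i) := by
  have h := isRealIndefinite_affinePoint (sum_star b i) (hasCore_star b i)
    (mul_neg_of_pos_of_neg (by norm_num) hb)
  rw [ht] at h
  convert h using 1
  rw [starPoint, affinePoint_inj, complexify_star]

theorem isRealSemidefinite_pairPoint {t a c : ℝ} (hac : a ^ 2 = 3 - 2 * c)
    (ht : 24 - 8 * c = t) (hc : 0 ≤ c + 3) (q : {q : Fin 4 × Fin 4 // q.1 ≠ q.2}) :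
    IsRealSemidefinite t (pairPoint a c q) := by
  have h := isRealSemidefinite_affinePoint (sum_pairPt a c q.2) (hasCore_pairPt hac q.2)
    (mul_nonneg (by norm_num) hc)
  rw [ht] at h
  convert h using 1
  rw [pairPoint, affinePoint_inj, complexify_pairPt]

theorem isRealIndefinite_pairPoint {t a c : ℝ} (hac : a ^ 2 = 3 - 2 * c)
    (ht : 24 - 8 * c = t) (hc : c + 3 < 0) (q : {q : Fin 4 × Fin 4 // q.1 ≠ q.2}) :
    IsRealIndefinite t (pairPoint a c q) := by
  have h := isRealIndefinite_affinePoint (sum_pairPt a c q.2) (hasCore_pairPt hac q.2)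
    (mul_neg_of_pos_of_neg (by norm_num) hc)
  rw [ht] at h
  convert h using 1
  rw [pairPoint, affinePoint_inj, complexify_pairPt]

theorem isNonreal_starPoint {b : ℂ} (hb : b.im ≠ 0) (i : Fin 4) : IsNonreal (starPoint b i) := by
  refine isNonreal_affinePoint _ i ?_
  simpa [star] using hb

theorem isNonreal_pairPoint {a : ℂ} {c : ℝ} (ha : a.im ≠ 0)
    (q : {q : Fin 4 × Fin 4 // q.1 ≠ q.2}) : IsNonreal (pairPoint a c q) := by
  refine isNonreal_affinePoint _ q.1.1 ?_
  simpa [pairPt] using ha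

theorem exists_sq_eq_re_nonneg (w : ℂ) : ∃ z : ℂ, z ^ 2 = w ∧ 0 ≤ z.re := by
  obtain ⟨z, hz⟩ := IsAlgClosed.exists_pow_nat_eq w (n := 2) two_pos
  rcases le_total 0 z.re with h | h
  · exact ⟨z, hz, h⟩
  · exact ⟨-z, by rw [neg_sq, hz], by simpa using h⟩

end TetrahedralSymmetroid

open TetrahedralSymmetroid in
theorem mainTheorem8 :
    -- the family is equivariant for a five-dimensional real representation of S₄
    (∃ ρ : Equiv.Perm (Fin 4) →* Matrix.GeneralLinearGroup (Fin 5) ℝ,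
      ∀ (t : ℝ) (σ : Equiv.Perm (Fin 4)) (x : Fin 4 → ℝ),
        TetrahedralSymmetroid.pencil t (fun i => x (σ⁻¹ i)) =
          (ρ σ : Matrix (Fin 5) (Fin 5) ℝ) * TetrahedralSymmetroid.pencil t x *
            (ρ σ : Matrix (Fin 5) (Fin 5) ℝ).transpose) ∧
    -- for all but five values of t there are 20 nodes, which form three orbits
    (∀ t : ℝ, t ≠ -2 → t ≠ 0 → t ≠ 12 → t ≠ 16 → t ≠ 48 →
      (TetrahedralSymmetroid.nodes t).encard = 20 ∧
      (∀ p ∈ TetrahedralSymmetroid.nodes t,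
        (TetrahedralSymmetroid.pencil (t : ℂ) p.rep).rank = 3 ∧
        TetrahedralSymmetroid.IsNode (TetrahedralSymmetroid.symmetroidForm t) p) ∧
      ∃ O P Q : Set TetrahedralSymmetroid.CP3,
        TetrahedralSymmetroid.IsS4Orbit O ∧ O.encard = 12 ∧
        TetrahedralSymmetroid.IsS4Orbit P ∧ P.encard = 4 ∧
        TetrahedralSymmetroid.IsS4Orbit Q ∧ Q.encard = 4 ∧
        Disjoint O P ∧ Disjoint O Q ∧ Disjoint P Q ∧
        TetrahedralSymmetroid.nodes t = O ∪ P ∪ Q ∧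
        (48 < t →
          (∀ p ∈ P, TetrahedralSymmetroid.IsRealSemidefinite t p) ∧
          (∀ p ∈ Q, TetrahedralSymmetroid.IsRealSemidefinite t p) ∧
          (∀ p ∈ O, TetrahedralSymmetroid.IsRealIndefinite t p)) ∧
        (12 < t → t < 48 →
          (∀ p ∈ P, TetrahedralSymmetroid.IsRealSemidefinite t p) ∧
          (∀ p ∈ Q, TetrahedralSymmetroid.IsRealIndefinite t p) ∧
          (∀ p ∈ O, TetrahedralSymmetroid.IsRealSemidefinite t p)) ∧
        (0 < t → t < 12 →
          (∀ p ∈ P, TetrahedralSymmetroid.IsRealSemidefinite t p) ∧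
          (∀ p ∈ Q, TetrahedralSymmetroid.IsRealIndefinite t p) ∧
          (∀ p ∈ O, TetrahedralSymmetroid.IsNonreal p)) ∧
        (-2 < t → t < 0 →
          (∀ p ∈ P, TetrahedralSymmetroid.IsRealIndefinite t p) ∧
          (∀ p ∈ Q, TetrahedralSymmetroid.IsRealIndefinite t p) ∧
          (∀ p ∈ O, TetrahedralSymmetroid.IsNonreal p)) ∧
        (t < -2 →
          ∀ p ∈ O ∪ P ∪ Q, TetrahedralSymmetroid.IsNonreal p)) ∧
    -- the spectrahedron is empty for negative t
    (∀ t : ℝ, t < 0 → TetrahedralSymmetroid.spectrahedron t = ∅) := by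
  refine ⟨exists_equivariant_rep, fun t h2 h0 h12 h16 h48 => ?_,
    fun t ht => spectrahedron_eq_empty ht⟩
  obtain ⟨a, ha, -⟩ := exists_sq_eq_re_nonneg (((t - 12) / 4 : ℝ) : ℂ)
  -- Here `z` is the root of the discriminant of `8b² + 8b = t`. The choice `0 ≤ z.re` makes `b₁`
  -- the larger root in the real case, which fixes which 4-orbit is `P`.
  obtain ⟨z, hz, hz0⟩ := exists_sq_eq_re_nonneg ((1 + t / 2 : ℝ) : ℂ)
  obtain ⟨c, hc⟩ : ∃ c : ℝ, 24 - 8 * c = t := ⟨3 - t / 8, by ring⟩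
  obtain ⟨b₁, hb₁⟩ : ∃ b₁ : ℂ, b₁ = (-1 + z) / 2 := ⟨_, rfl⟩
  obtain ⟨b₂, hb₂⟩ : ∃ b₂ : ℂ, b₂ = (-1 - z) / 2 := ⟨_, rfl⟩
  have hct : 24 - 8 * (c : ℂ) = t := by rw [← hc]; push_cast; ring
  have hac : a ^ 2 = 3 - 2 * (c : ℂ) := by rw [ha, ← hc]; push_cast; ring
  have hz' : z ^ 2 = 1 + t / 2 := by rw [hz]; push_cast; ring
  have ht₁ : 8 * b₁ ^ 2 + 8 * b₁ = t := by rw [hb₁]; linear_combination 2 * hz'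
  have ht₂ : 8 * b₂ ^ 2 + 8 * b₂ = t := by rw [hb₂]; linear_combination 2 * hz'
  have hnodes := nodes_eq h0 h12 h48 hac hct ht₁ (b₂ := b₂) (by rw [hb₁, hb₂]; ring)
  have ha0 : a ≠ 0 := by
    rintro rfl
    exact h12 (by exact_mod_cast (by linear_combination -hct - 4 * hac : (t : ℂ) = 12))
  -- The product is `a² - c² = (1 - c)(c + 3)`, which vanishes only for `t = 16` and `t = 48`.
  have hac2 : (a + c) * (a - c) ≠ 0 := by
    intro h
    have : ((t : ℂ) - 16) * (t - 48) = 0 := by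
      rw [← hct]
      linear_combination 64 * hac - 64 * h
    rcases mul_eq_zero.1 this with h | h
    · exact h16 (by exact_mod_cast sub_eq_zero.1 h)
    · exact h48 (by exact_mod_cast sub_eq_zero.1 h)
  have hs : a + c ≠ 0 := left_ne_zero_of_mul hac2
  have hd : a - c ≠ 0 := right_ne_zero_of_mul hac2
  have hz1 : z ≠ 0 := by
    rintro rfl
    exact h2 (by exact_mod_cast (by linear_combination -2 * hz' : (t : ℂ) = -2))
  have hb12 : b₁ ≠ b₂ := by
    rw [hb₁, hb₂]
    intro h
    exact hz1 (by linear_combination h)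
  have hb10 : b₁ ≠ 0 := by
    rintro rfl
    exact h0 (by exact_mod_cast (by linear_combination -ht₁ : (t : ℂ) = 0))
  have hb20 : b₂ ≠ 0 := by
    rintro rfl
    exact h0 (by exact_mod_cast (by linear_combination -ht₂ : (t : ℂ) = 0))
  have hOP := disjoint_range_pairPoint (b := b₁) hs hd
  have hOQ := disjoint_range_pairPoint (b := b₂) hs hd
  have hPQ := disjoint_range_starPoint hb12
  refine ⟨?_, ?_, Set.range (pairPoint a c), Set.range (starPoint b₁), Set.range (starPoint b₂),
    isS4Orbit_range_pairPoint .., encard_range_pairPoint ha0 hs hd,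
    isS4Orbit_range_starPoint _, encard_range_starPoint hb10,
    isS4Orbit_range_starPoint _, encard_range_starPoint hb20, hOP, hOQ, hPQ, hnodes, ?_⟩
  · rw [hnodes, Set.encard_union_eq (Set.disjoint_union_left.2 ⟨hOQ, hPQ⟩),
      Set.encard_union_eq hOP, encard_range_pairPoint ha0 hs hd, encard_range_starPoint hb10,
      encard_range_starPoint hb20]
    norm_num
  · rw [hnodes]
    rintro _ ((⟨q, rfl⟩ | ⟨i, rfl⟩) | ⟨i, rfl⟩)
    · exact ⟨(rank_pencil_rep ..).trans (rank_pencil_pairPt hac hct h48 q.2),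
        isNode_affinePoint _ (nodeAt_pairPt hac hct h12 h16 h48 q.2)⟩
    · exact ⟨(rank_pencil_rep ..).trans (rank_pencil_star ht₁ h0 h48 i),
        isNode_affinePoint _ (nodeAt_star ht₁ h2 h0 h16 h48 i)⟩
    · exact ⟨(rank_pencil_rep ..).trans (rank_pencil_star ht₂ h0 h48 i),
        isNode_affinePoint _ (nodeAt_star ht₂ h2 h0 h16 h48 i)⟩
  have hO : t < 12 → ∀ p ∈ Set.range (pairPoint a c), IsNonreal p := by
    rintro ht _ ⟨q, rfl⟩
    exact isNonreal_pairPoint (im_ne_zero_of_sq ha (by linarith)) q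
  have haR : 12 < t → ∃ α : ℝ, a = α ∧ α ^ 2 = 3 - 2 * c := by
    intro ht
    have h := eq_ofReal_of_sq ha (by linarith)
    refine ⟨a.re, h, ?_⟩
    rw [h] at hac
    exact_mod_cast hac
  have hbR : -2 < t → ∃ r : ℝ, 0 ≤ r ∧ r ^ 2 = 1 + t / 2 ∧
      b₁ = ((-1 + r) / 2 : ℝ) ∧ b₂ = ((-1 - r) / 2 : ℝ) := by
    intro ht
    have h := eq_ofReal_of_sq hz (by linarith)
    refine ⟨z.re, hz0, ?_, ?_, ?_⟩
    · rw [h] at hz'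
      exact_mod_cast hz'
    · rw [hb₁]; push_cast; rw [← h]
    · rw [hb₂]; push_cast; rw [← h]
  -- With `r² = 1 + t/2`, `b₁(b₁ + 3) = (r - 1)(r + 5)/4` changes sign at `t = 0` and `b₂(b₂ + 3) =
  -- (r + 1)(r - 5)/4` at `t = 48`, while `c + 3 = (48 - t)/8`.
  refine ⟨fun ht => ?_, fun ht ht' => ?_, fun ht ht' => ?_, fun ht ht' => ?_, fun ht => ?_⟩
  · obtain ⟨α, rfl, hα⟩ := haR (by linarith)
    obtain ⟨r, hr0, hr, rfl, rfl⟩ := hbR (by linarith)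
    refine ⟨?_, ?_, ?_⟩
    · rintro _ ⟨i, rfl⟩
      exact isRealSemidefinite_starPoint (by linear_combination 2 * hr) (by nlinarith) i
    · rintro _ ⟨i, rfl⟩
      exact isRealSemidefinite_starPoint (by linear_combination 2 * hr) (by nlinarith) i
    · rintro _ ⟨q, rfl⟩
      exact isRealIndefinite_pairPoint hα hc (by linarith) q
  · obtain ⟨α, rfl, hα⟩ := haR (by linarith)
    obtain ⟨r, hr0, hr, rfl, rfl⟩ := hbR (by linarith)
    refine ⟨?_, ?_, ?_⟩
    · rintro _ ⟨i, rfl⟩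
      exact isRealSemidefinite_starPoint (by linear_combination 2 * hr) (by nlinarith) i
    · rintro _ ⟨i, rfl⟩
      exact isRealIndefinite_starPoint (by linear_combination 2 * hr) (by nlinarith) i
    · rintro _ ⟨q, rfl⟩
      exact isRealSemidefinite_pairPoint hα hc (by linarith) q
  · obtain ⟨r, hr0, hr, rfl, rfl⟩ := hbR (by linarith)
    refine ⟨?_, ?_, hO ht'⟩
    · rintro _ ⟨i, rfl⟩
      exact isRealSemidefinite_starPoint (by linear_combination 2 * hr) (by nlinarith) i
    · rintro _ ⟨i, rfl⟩
      exact isRealIndefinite_starPoint (by linear_combination 2 * hr) (by nlinarith) i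
  · obtain ⟨r, hr0, hr, rfl, rfl⟩ := hbR (by linarith)
    refine ⟨?_, ?_, hO (by linarith)⟩
    · rintro _ ⟨i, rfl⟩
      exact isRealIndefinite_starPoint (by linear_combination 2 * hr) (by nlinarith) i
    · rintro _ ⟨i, rfl⟩
      exact isRealIndefinite_starPoint (by linear_combination 2 * hr) (by nlinarith) i
  · have hzi := im_ne_zero_of_sq hz (by linarith)
    rintro _ ((⟨q, rfl⟩ | ⟨i, rfl⟩) | ⟨i, rfl⟩)
    · exact hO (by linarith) _ ⟨q, rfl⟩
    · exact isNonreal_starPoint (by simpa [hb₁] using hzi) i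
    · exact isNonreal_starPoint (by simpa [hb₂] using hzi) i
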